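/- Let $\Gamma$ be a finite abelian group, written multiplicatively. A mould is a family $M=(M_{\sigma_1,\dots,\sigma_m}(x_1,\dots,x_m))_{m\ge 0,\ \sigma_i\in\Gamma}$ with $M_{\sigma_1,\dots,\sigma_m}\in\mathbb Q(x_1,\dots,x_m)$, so that $M(\emptyset)\in\mathbb Q$. For a word $w=\binom{\sigma_1,\dots,\sigma_m}{y_1,\dots,y_m}$ whose entries $y_i$ are algebraically independent over $\mathbb Q$, write $M(w)=M_{\sigma_1,\dots,\sigma_m}(y_1,\dots,y_m)$, and let $\mathbf v_m=\binom{\sigma_1,\dots,\sigma_m}{v_1,\dots,v_m}$ with the $v_i$ independent variables. The product of moulds is $(A\times B)(\mathbf v_m)=\sum_{\mathbf v_m=\alpha\beta}A(\alpha)B(\beta)$, with unit $I=(1,0,0,\dots)$. Let $\overline{\mathrm{ARI}}(\Gamma)$ and $\overline{\mathrm{GARI}}(\Gamma)$ be the sets of moulds with $M(\emptyset)=0$ and with $M(\emptyset)=1$ respectively, and for $A\in\overline{\mathrm{ARI}}(\Gamma)$ put $\exp_\times(A)=\sum_{k\ge0}\frac1{k!}A^{\times k}\in\overline{\mathrm{GARI}}(\Gamma)$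 (a finite sum in each depth $m$). On the $\mathbb Q(v_1,v_2,\dots)$-linear span of words, let $\shuffle$ be the shuffle product, given by $\emptyset\shuffle\omega=\omega\shuffle\emptyset=\omega$ and $a\omega\shuffle b\eta=a(\omega\shuffle b\eta)+b(a\omega\shuffle\eta)$ for letters $a,b$. Let $\shuffle_*$ be given by $\emptyset\shuffle_*\omega=\omega\shuffle_*\emptyset=\omega$ and, for letters $a=\binom{\sigma}{v}$, $b=\binom{\sigma'}{v'}$ with $v\ne v'$, $$a\omega\shuffle_* b\eta=a(\omega\shuffle_* b\eta)+b(a\omega\shuffle_*\eta)+\frac1{v-v'}\left\{\binom{\sigma\sigma'}{v}(\omega\shuffle_*\eta)-\binom{\sigma\sigma'}{v'}(\omega\shuffle_*\eta)\right\}$$ (and $a\omega\shuffle_* b\eta=0$ if $v=v'$). Extend each mould $M$ linearly to combinations of words. For $p,q\ge1$ and $\sigma_1,\dots,\sigma_{p+q}\in\Gamma$ let $\omega=\binom{\sigma_1,\dots,\sigma_p}{v_1,\dots,v_p}$ and $\eta=\binom{\sigma_{p+1},\dots,\sigma_{p+q}}{v_{p+1},\dots,v_{p+q}}$. Then $\overline{\mathrm{ARI}}(\Gamma)_{\mathrm{al}}$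 (resp. $\overline{\mathrm{ARI}}(\Gamma)_{\mathrm{il}}$) is the set of $M\in\overline{\mathrm{ARI}}(\Gamma)$ with $M(\omega\shuffle\eta)=0$ (resp. $M(\omega\shuffle_*\eta)=0$) for all such $\omega,\eta$, and $\overline{\mathrm{GARI}}(\Gamma)_{\mathrm{as}}$ (resp. $\overline{\mathrm{GARI}}(\Gamma)_{\mathrm{is}}$) is the set of $M\in\overline{\mathrm{GARI}}(\Gamma)$ with $M(\omega\shuffle\eta)=M(\omega)M(\eta)$ (resp. $M(\omega\shuffle_*\eta)=M(\omega)M(\eta)$) for all such $\omega,\eta$. For words $a=\binom{\sigma_1,\dots,\sigma_k}{y_1,\dots,y_k}$ with $k\ge 1$ and $b=\binom{\tau_1,\dots,\tau_l}{z_1,\dots,z_l}$ with $l\ge 0$, put $${}_a\lfloor b=\binom{\tau_1,\dots,\tau_l}{z_1-y_k,\dots,z_l-y_k},\qquad a\rceil^b=\binom{\sigma_1,\dots,\sigma_{k-1},\sigma_k\tau_1\cdots\tau_l}{y_1,\dots,y_{k-1},y_k}.$$ For $B\in\overline{\mathrm{GARI}}(\Gamma)$ the map $\mathrm{ganit}_v(B)$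 on moulds is defined by $(\mathrm{ganit}_v(B)(A))(\emptyset)=A(\emptyset)$ and, for $r\ge1$, $$(\mathrm{ganit}_v(B)(A))(\mathbf v_r)=\sum_{s\ge1}\ \sum_{\substack{\mathbf v_r=a_1b_1\cdots a_sb_s\\ a_1,\dots,a_s\ne\emptyset\\ b_1,\dots,b_{s-1}\ne\emptyset}}B({}_{a_1}\lfloor b_1)\cdots B({}_{a_s}\lfloor b_s)\,A(a_1\rceil^{b_1}\cdots a_s\rceil^{b_s}).$$ Let $\mathrm{pic}\in\overline{\mathrm{GARI}}(\Gamma)$ be the mould $\mathrm{pic}(\emptyset)=1$, $\mathrm{pic}(\mathbf v_m)=\frac1{v_1\cdots v_m}$ for $m\ge 1$. Then $\mathrm{ganit}_v(\mathrm{pic})(\exp_\times(A))=\exp_\times(\mathrm{ganit}_v(\mathrm{pic})(A))$ for every $A\in\overline{\mathrm{ARI}}(\Gamma)$. Moreover, $\exp_\times$ maps $\overline{\mathrm{ARI}}(\Gamma)_{\mathrm{al}}$ into $\overline{\mathrm{GARI}}(\Gamma)_{\mathrm{as}}$ and $\overline{\mathrm{ARI}}(\Gamma)_{\mathrm{il}}$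 into $\overline{\mathrm{GARI}}(\Gamma)_{\mathrm{is}}$, the map $\mathrm{ganit}_v(\mathrm{pic})$ maps $\overline{\mathrm{ARI}}(\Gamma)_{\mathrm{al}}$ into $\overline{\mathrm{ARI}}(\Gamma)_{\mathrm{il}}$ and $\overline{\mathrm{GARI}}(\Gamma)_{\mathrm{as}}$ into $\overline{\mathrm{GARI}}(\Gamma)_{\mathrm{is}}$, and the resulting square commutes: $$\begin{array}{ccc}\overline{\mathrm{GARI}}(\Gamma)_{\mathrm{as}}&\xrightarrow{\ \mathrm{ganit}_v(\mathrm{pic})\ }&\overline{\mathrm{GARI}}(\Gamma)_{\mathrm{is}}\\ {\scriptstyle\exp_\times}\uparrow&&\uparrow{\scriptstyle\exp_\times}\\ \overline{\mathrm{ARI}}(\Gamma)_{\mathrm{al}}&\xrightarrow{\ \mathrm{ganit}_v(\mathrm{pic})\ }&\overline{\mathrm{ARI}}(\Gamma)_{\mathrm{il}}\end{array}$$ -/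

import Mathlib

noncomputable section

/-- The field `ℚ(x_i | i ∈ ι)` of rational functions. -/
abbrev RatField (ι : Type) : Type := FractionRing (MvPolynomial ι ℚ)

/-- The variable `x_i` of `ℚ(x_i | i ∈ ι)`. -/
def RatField.var {ι : Type} (i : ι) : RatField ι :=
  algebraMap (MvPolynomial ι ℚ) (RatField ι) (MvPolynomial.X i)

open Classical in
/-- Substitution of a family `y` of elements of a field `L ⊇ ℚ` into a rational function: the
field embedding `ℚ(x_1, …, x_m) → L` with `x_i ↦ y_i`. It exists exactly when `y` is algebraically
independent, and only such families are substituted below; the value `0` is a dummy. -/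
def RatField.subst {ι L : Type} [Field L] [Algebra ℚ L] (y : ι → L) (f : RatField ι) : L :=
  if h : AlgebraicIndependent ℚ y then
    IsFractionRing.liftAlgHom (K := RatField ι) (g := MvPolynomial.aeval y)
      (algebraicIndependent_iff_injective_aeval.1 h) f
  else 0

/-- Moulds: for every depth `m` and every `(σ_1, …, σ_m) ∈ Γ^m`, a rational function
`M_{σ_1, …, σ_m}(x_1, …, x_m) ∈ ℚ(x_1, …, x_m)`. In depth `0` this is an element of
`ℚ(∅) = ℚ`. -/
abbrev Mould (Γ : Type*) : Type _ := (m : ℕ) → (Fin m → Γ) → RatField (Fin m)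

/-- Words whose letters are columns `(σ, v)` with `σ ∈ Γ` and `v` in the field `L`. -/
abbrev MouldWord (Γ : Type*) (L : Type) : Type _ := List (Γ × L)

namespace Mould

variable {Γ : Type*} {L : Type} [Field L]

/-- The generic word with upper row `(σ_1, …, σ_m)` and lower row `(v_1, …, v_m)`, the variables. -/
def genericWord {m : ℕ} (σ : Fin m → Γ) : MouldWord Γ (RatField (Fin m)) :=
  List.ofFn fun i => (σ i, RatField.var i)

/-- The value `M(w) = M_{σ_1, …, σ_m}(y_1, …, y_m)` of a mould at the word with letters
`(σ_i, y_i)`. -/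
def eval [Algebra ℚ L] (M : Mould Γ) (w : MouldWord Γ L) : L :=
  RatField.subst (fun i => (w.get i).2) (M w.length fun i => (w.get i).1)

/-- The product `(A × B)(v_m) = ∑_{v_m = αβ} A(α) B(β)`. -/
def mul (A B : Mould Γ) : Mould Γ := fun m σ =>
  ∑ i ∈ Finset.range (m + 1),
    A.eval ((genericWord σ).take i) * B.eval ((genericWord σ).drop i)

/-- The unit `I = (1, 0, 0, …)`. -/
def unit : Mould Γ := fun m _ => if m = 0 then 1 else 0

/-- The power `A^{× k}`. -/
def pow (A : Mould Γ) : ℕ → Mould Γ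
  | 0 => unit
  | k + 1 => mul (pow A k) A

/-- `exp_×(A) = ∑_{k ≥ 0} A^{× k} / k!`, in every depth. For a mould `A` with `A(∅) = 0` only
the terms with `k ≤ m` can be nonzero in depth `m`. -/
def expTimes (A : Mould Γ) : Mould Γ := fun m σ =>
  ∑ᶠ k : ℕ, ((k.factorial : RatField (Fin m)))⁻¹ * A.pow k m σ

/-- The moulds with `M(∅) = 0`. -/
def ARI (Γ : Type*) : Set (Mould Γ) := {M | M 0 ![] = 0}

/-- The moulds with `M(∅) = 1`. -/
def GARI (Γ : Type*) : Set (Mould Γ) := {M | M 0 ![] = 1}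

/-- The linear map `f ↦ a f` on the span of all words, for a letter `a`. -/
def prepend (a : Γ × L) : (MouldWord Γ L →₀ L) →ₗ[L] (MouldWord Γ L →₀ L) :=
  Finsupp.lmapDomain L L (List.cons a)

/-- The shuffle product of two words, in the span of all words. -/
def shuffle : MouldWord Γ L → MouldWord Γ L → (MouldWord Γ L →₀ L)
  | [], η => Finsupp.single η 1
  | a :: ω, [] => Finsupp.single (a :: ω) 1
  | a :: ω, b :: η => prepend a (shuffle ω (b :: η)) + prepend b (shuffle (a :: ω) η)
termination_by ω η => ω.length + η.length

open Classical in
/-- The product `ш_*` of two words, in the span of all words. -/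
def shuffleStar [Mul Γ] : MouldWord Γ L → MouldWord Γ L → (MouldWord Γ L →₀ L)
  | [], η => Finsupp.single η 1
  | a :: ω, [] => Finsupp.single (a :: ω) 1
  | a :: ω, b :: η =>
    if a.2 = b.2 then 0
    else prepend a (shuffleStar ω (b :: η)) + prepend b (shuffleStar (a :: ω) η)
      + (a.2 - b.2)⁻¹ • (prepend (a.1 * b.1, a.2) (shuffleStar ω η)
        - prepend (a.1 * b.1, b.2) (shuffleStar ω η))
termination_by ω η => ω.length + η.length

/-- `∑_α c_α M(α)` for a linear combination `∑_α c_α α` of words. -/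
def evalLin [Algebra ℚ L] (M : Mould Γ) (f : MouldWord Γ L →₀ L) : L :=
  f.sum fun α c => c * M.eval α

/-- The word with upper row `(σ_1, …, σ_p)` and lower row `(v_{k+1}, …, v_{k+p})`, over the field
of rational functions in infinitely many variables (`v_{i+1}` being `RatField.var i`). -/
def varWord (k : ℕ) {p : ℕ} (σ : Fin p → Γ) : MouldWord Γ (RatField ℕ) :=
  List.ofFn fun i => (σ i, RatField.var (k + (i : ℕ)))

/-- Alternal moulds. -/
def ARIal (Γ : Type*) : Set (Mould Γ) :=
  {M | M ∈ ARI Γ ∧ ∀ (p q : ℕ), 1 ≤ p → 1 ≤ q → ∀ (σ : Fin p → Γ) (τ : Fin q → Γ),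
    M.evalLin (shuffle (varWord 0 σ) (varWord p τ)) = 0}

/-- Alternil moulds. -/
def ARIil (Γ : Type*) [Mul Γ] : Set (Mould Γ) :=
  {M | M ∈ ARI Γ ∧ ∀ (p q : ℕ), 1 ≤ p → 1 ≤ q → ∀ (σ : Fin p → Γ) (τ : Fin q → Γ),
    M.evalLin (shuffleStar (varWord 0 σ) (varWord p τ)) = 0}

/-- Symmetral moulds. -/
def GARIas (Γ : Type*) : Set (Mould Γ) :=
  {M | M ∈ GARI Γ ∧ ∀ (p q : ℕ), 1 ≤ p → 1 ≤ q → ∀ (σ : Fin p → Γ) (τ : Fin q → Γ),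
    M.evalLin (shuffle (varWord 0 σ) (varWord p τ)) =
      M.eval (varWord 0 σ) * M.eval (varWord p τ)}

/-- Symmetril moulds. -/
def GARIis (Γ : Type*) [Mul Γ] : Set (Mould Γ) :=
  {M | M ∈ GARI Γ ∧ ∀ (p q : ℕ), 1 ≤ p → 1 ≤ q → ∀ (σ : Fin p → Γ) (τ : Fin q → Γ),
    M.evalLin (shuffleStar (varWord 0 σ) (varWord p τ)) =
      M.eval (varWord 0 σ) * M.eval (varWord p τ)}

/-- The lower flexion `_a⌊b`: the last lower entry of `a` is subtracted from all lower entries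
of `b` (and `b` is unchanged if `a` is empty). -/
def lowerFlex (a b : MouldWord Γ L) : MouldWord Γ L :=
  match a.getLast? with
  | none => b
  | some x => b.map fun y => (y.1, y.2 - x.2)

/-- The upper flexion `a⌉^b`: the last upper entry of `a` is multiplied by all upper entries
of `b` (and the result is empty if `a` is empty). -/
def upperFlex [CommGroup Γ] (a b : MouldWord Γ L) : MouldWord Γ L :=
  match a.getLast? with
  | none => []
  | some x => a.dropLast ++ [(x.1 * (b.map Prod.fst).prod, x.2)]

/-- `d = [(a_1, b_1), …, (a_s, b_s)]` is a decomposition `w = a_1 b_1 ⋯ a_s b_s` with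
`a_1, …, a_s ≠ ∅` and `b_1, …, b_{s-1} ≠ ∅`. -/
def IsDecomp {α : Type*} (w : List α) (d : List (List α × List α)) : Prop :=
  (d.map fun c => c.1 ++ c.2).flatten = w ∧ (∀ c ∈ d, c.1 ≠ []) ∧ ∀ c ∈ d.dropLast, c.2 ≠ []

theorem finite_isDecomp {α : Type*} (w : List α) : {d | IsDecomp w d}.Finite := by
  suffices H : ∀ (n : ℕ) (w : List α), w.length ≤ n →
      {d : List (List α × List α) |
        (d.map fun c => c.1 ++ c.2).flatten = w ∧ ∀ c ∈ d, c.1 ≠ []}.Finite from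
    (H w.length w le_rfl).subset fun d hd => ⟨hd.1, hd.2.1⟩
  intro n
  induction n with
  | zero =>
    intro w hw
    refine (Set.finite_singleton []).subset ?_
    rintro d ⟨hd, hne⟩
    rcases d with _ | ⟨c, d⟩
    · rfl
    · exfalso
      obtain rfl : w = [] := List.length_eq_zero_iff.1 (by omega)
      have h := hne c (by simp)
      simp_all
  | succ n ih =>
    intro w hw
    refine ((Set.finite_singleton []).union
      (Set.Finite.biUnion (Finset.range (w.length + 1) ×ˢ Finset.range (w.length + 1)).finite_toSet
        fun ij _ => Set.Finite.biUnion (Set.finite_singleton ((w.drop (ij.1 + 1)).drop ij.2))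
          fun w' _ => Set.Finite.image
            (fun d => (w.take (ij.1 + 1), (w.drop (ij.1 + 1)).take ij.2) :: d)
            (ih ((w.drop (ij.1 + 1)).drop ij.2)
              (by simp only [List.length_drop]; omega)))).subset ?_
    rintro d ⟨hd, hne⟩
    rcases d with _ | ⟨⟨a, b⟩, d⟩
    · exact Or.inl rfl
    · right
      have ha : a ≠ [] := hne (a, b) (by simp)
      obtain ⟨x, a, rfl⟩ := List.exists_cons_of_ne_nil ha
      simp only [List.map_cons, List.flatten_cons, List.append_assoc] at hd
      subst hd
      simp only [Set.mem_iUnion]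
      refine ⟨(a.length, b.length), ?_, _, rfl, d, ⟨?_, fun c hc => hne c (by simp [hc])⟩, ?_⟩
      · simp; omega
      · simp
      · simp

/-- The finite set of all decompositions `w = a_1 b_1 ⋯ a_s b_s` as in `IsDecomp`. -/
def decomps {α : Type*} (w : List α) : Finset (List (List α × List α)) :=
  (finite_isDecomp w).toFinset

/-- `ganit_v(B)(A)(v_r) = ∑ B(_{a_1}⌊b_1) ⋯ B(_{a_s}⌊b_s) A(a_1⌉^{b_1} ⋯ a_s⌉^{b_s})`, summed over
all `s` and all decompositions `v_r = a_1 b_1 ⋯ a_s b_s`. For `r ≥ 1` they have `s ≥ 1`; for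
`r = 0` only `s = 0` occurs, and the sum is `A(∅)`. -/
def ganit [CommGroup Γ] (B A : Mould Γ) : Mould Γ := fun _ σ =>
  ∑ d ∈ decomps (genericWord σ),
    (d.map fun c => B.eval (lowerFlex c.1 c.2)).prod *
      A.eval (d.map fun c => upperFlex c.1 c.2).flatten

/-- `pic(v_m) = 1 / (v_1 ⋯ v_m)`. -/
def pic : Mould Γ := fun _ _ => (∏ i, RatField.var i)⁻¹

end Mould

end

/-! A mould is a functional on words, and its product is dual to deconcatenation. Dually,
ganit_v(pic) is composition with a linear map G on words, sending a word to its contractions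
weighted by products of 1/(z - y); `ganitSum w F` is F(G(w)), while `quasiSum κ ω η F` is F at the
shuffle (κ = 0) or at ш_* (κ = 1). Three facts carry the proof.

`ganitSum_splitSum`: G respects deconcatenation. Hence ganit_v(pic) is multiplicative, and it
commutes with exp_×, which is a finite sum in each depth.

`quasiSum_one_ganitSum`: G(ω ш_* η) = G(ω) ш G(η) when the lower entries are distinct. Hence a
relation M(ω ш η) = c M(ω)M(η) becomes the same relation for ш_*; c = 0 and c = 1 give the two
horizontal arrows. The proof expands both sides by leading letter. The weights form a character of
ш_* by partial fractions (`quasiSum_one_polarWeight`), and the contraction terms cancel what merging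
the two first letters adds.

`quasiSum_splitSum`: deconcatenation is multiplicative for both products. Hence the exponential of a
primitive functional is group-like (`quasiSum_divPow`), which gives the vertical arrows.

Since mould values are meaningful only at algebraically independent entries, identities are
transported from generic words by field embeddings, and each congruence lemma records that the words
produced stay independent. -/

noncomputable section

namespace Mould

/-! ### Functionals on words: deconcatenation, quasi-shuffles and contractions -/

section Combinatorics

set_option linter.unusedSectionVars false

variable {Γ : Type*} [CommGroup Γ] {L : Type} [Field L]

/-- `F ↦ F(a ·)`. -/
def precons (a : Γ × L) : (MouldWord Γ L → L) →ₗ[L] (MouldWord Γ L → L) :=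
  LinearMap.funLeft L L (List.cons a)

@[simp] theorem precons_apply (a : Γ × L) (F : MouldWord Γ L → L) :
    precons a F = fun u => F (a :: u) := rfl

/-- The value of (the linear extension of) `F` at the quasi-shuffle product of two words, in which
the contraction terms are weighted by `κ`: `κ = 0` is the shuffle product, `κ = 1` is `ш_*`. -/
def quasiSum (κ : ℕ) : MouldWord Γ L → MouldWord Γ L → ((MouldWord Γ L → L) →ₗ[L] L)
  | [], η => LinearMap.proj η
  | a :: ω, [] => LinearMap.proj (a :: ω)
  | a :: ω, b :: η =>
    quasiSum κ ω (b :: η) ∘ₗ precons a + quasiSum κ (a :: ω) η ∘ₗ precons b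
      + (κ * (a.2 - b.2)⁻¹ : L) • (quasiSum κ ω η ∘ₗ precons (a.1 * b.1, a.2)
        - quasiSum κ ω η ∘ₗ precons (a.1 * b.1, b.2))
termination_by ω η => ω.length + η.length

/-- `∑_{w = c w'} Φ(c, w')`. -/
def splitSum : MouldWord Γ L → ((MouldWord Γ L → MouldWord Γ L → L) →ₗ[L] L)
  | [] => (LinearMap.proj [] : (MouldWord Γ L → L) →ₗ[L] L) ∘ₗ LinearMap.proj []
  | x :: w => (LinearMap.proj (x :: w) : (MouldWord Γ L → L) →ₗ[L] L) ∘ₗ LinearMap.proj [] +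
      splitSum w ∘ₗ LinearMap.funLeft L (MouldWord Γ L → L) (List.cons x)

/-- `ganitSum (x :: w)` with the first block already started by the letter `x`. -/
def blockSum : Γ × L → MouldWord Γ L → ((MouldWord Γ L → L) →ₗ[L] L)
  | x, [] => LinearMap.proj [x]
  | x, y :: w => blockSum y w ∘ₗ precons x + (y.2 - x.2)⁻¹ • blockSum (x.1 * y.1, x.2) w

/-- The sum over all decompositions of a word into blocks which defines `ganit pic`. -/
def ganitSum : MouldWord Γ L → ((MouldWord Γ L → L) →ₗ[L] L)
  | [] => LinearMap.proj []
  | x :: w => blockSum x w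

/-- `∏ 1 / (z_j - x)`, over the lower entries `z_j` of a word. -/
def polarWeight (x : L) (w : MouldWord Γ L) : L := (w.map fun y => (y.2 - x)⁻¹).prod

/-- The product of the upper entries of a word. -/
def upperProd (w : MouldWord Γ L) : Γ := (w.map Prod.fst).prod

@[simp] theorem polarWeight_nil (x : L) : polarWeight (Γ := Γ) x [] = 1 := rfl

@[simp] theorem polarWeight_cons (x : L) (y : Γ × L) (w : MouldWord Γ L) :
    polarWeight x (y :: w) = (y.2 - x)⁻¹ * polarWeight x w := by simp [polarWeight]

@[simp] theorem upperProd_nil : upperProd ([] : MouldWord Γ L) = 1 := rfl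

@[simp] theorem upperProd_cons (y : Γ × L) (w : MouldWord Γ L) :
    upperProd (y :: w) = y.1 * upperProd w := by simp [upperProd]

section Apply

variable (κ : ℕ) (F : MouldWord Γ L → L) (Φ : MouldWord Γ L → MouldWord Γ L → L)
  (a b x : Γ × L) (ω η w : MouldWord Γ L)

@[simp] theorem quasiSum_nil_left : quasiSum κ [] η F = F η := by simp [quasiSum]

@[simp] theorem quasiSum_nil_right : quasiSum κ ω [] F = F ω := by
  cases ω <;> simp [quasiSum]

theorem quasiSum_cons_cons : quasiSum κ (a :: ω) (b :: η) F =
    quasiSum κ ω (b :: η) (fun u => F (a :: u)) + quasiSum κ (a :: ω) η (fun u => F (b :: u))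
      + κ * (a.2 - b.2)⁻¹ * (quasiSum κ ω η (fun u => F ((a.1 * b.1, a.2) :: u))
        - quasiSum κ ω η (fun u => F ((a.1 * b.1, b.2) :: u))) := by
  rw [quasiSum]; simp

@[simp] theorem splitSum_nil : splitSum [] Φ = Φ [] [] := rfl

@[simp] theorem splitSum_cons :
    splitSum (x :: w) Φ = Φ [] (x :: w) + splitSum w (fun c w' => Φ (x :: c) w') := rfl

@[simp] theorem blockSum_nil : blockSum x [] F = F [x] := rfl

theorem blockSum_cons : blockSum a (b :: w) F = blockSum b w (fun u => F (a :: u))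
    + (b.2 - a.2)⁻¹ * blockSum (a.1 * b.1, a.2) w F := rfl

@[simp] theorem ganitSum_nil : ganitSum [] F = F [] := rfl

@[simp] theorem ganitSum_cons : ganitSum (x :: w) F = blockSum x w F := rfl

end Apply

section Linear

variable {X V : Type*} [AddCommGroup V] [Module L V]

theorem map_fun_add (T : (X → V) →ₗ[L] L) (F F' : X → V) :
    T (fun u => F u + F' u) = T F + T F' := T.map_add F F'

theorem map_fun_mul (T : (X → L) →ₗ[L] L) (c : L) (F : X → L) :
    T (fun u => c * F u) = c * T F := T.map_smul c F

theorem map_fun_mul_right (T : (X → L) →ₗ[L] L) (c : L) (F : X → L) :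
    T (fun u => F u * c) = T F * c := by
  simp_rw [mul_comm _ c]; exact T.map_smul c F

theorem map_fun_sum {ι : Type*} (T : (X → L) →ₗ[L] L) (s : Finset ι) (F : ι → X → L) :
    T (fun u => ∑ i ∈ s, F i u) = ∑ i ∈ s, T (F i) := by
  rw [← map_sum]; congr 1; ext u; simp

theorem splitSum_fun_add (w : MouldWord Γ L) (Φ Ψ : MouldWord Γ L → MouldWord Γ L → L) :
    splitSum w (fun c w' => Φ c w' + Ψ c w') = splitSum w Φ + splitSum w Ψ :=
  (splitSum w).map_add Φ Ψ

theorem splitSum_fun_sub (w : MouldWord Γ L) (Φ Ψ : MouldWord Γ L → MouldWord Γ L → L) :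
    splitSum w (fun c w' => Φ c w' - Ψ c w') = splitSum w Φ - splitSum w Ψ :=
  (splitSum w).map_sub Φ Ψ

theorem splitSum_fun_mul (w : MouldWord Γ L) (k : L) (Φ : MouldWord Γ L → MouldWord Γ L → L) :
    splitSum w (fun c w' => k * Φ c w') = k * splitSum w Φ := (splitSum w).map_smul k Φ

theorem splitSum_fun_mul_right (w : MouldWord Γ L) (k : L)
    (Φ : MouldWord Γ L → MouldWord Γ L → L) :
    splitSum w (fun c w' => Φ c w' * k) = splitSum w Φ * k := by
  simp_rw [mul_comm _ k]; exact (splitSum w).map_smul k Φ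

theorem splitSum_fun_sum {ι : Type*} (s : Finset ι) (w : MouldWord Γ L)
    (Φ : ι → MouldWord Γ L → MouldWord Γ L → L) :
    splitSum w (fun c w' => ∑ i ∈ s, Φ i c w') = ∑ i ∈ s, splitSum w (Φ i) := by
  rw [← map_sum]; congr 1; ext u v; simp

end Linear

/-! ### Congruence -/

theorem splitSum_congr {w : MouldWord Γ L} {Φ Ψ : MouldWord Γ L → MouldWord Γ L → L}
    (h : ∀ c w', c ++ w' = w → Φ c w' = Ψ c w') : splitSum w Φ = splitSum w Ψ := by
  induction w generalizing Φ Ψ with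
  | nil => exact h [] [] rfl
  | cons x w ih =>
    rw [splitSum_cons, splitSum_cons, h [] _ rfl, ih]
    rintro c w' rfl
    exact h _ _ rfl

theorem splitSum_eq_sum_range (w : MouldWord Γ L) (Φ : MouldWord Γ L → MouldWord Γ L → L) :
    splitSum w Φ = ∑ i ∈ Finset.range (w.length + 1), Φ (w.take i) (w.drop i) := by
  induction w generalizing Φ with
  | nil => simp
  | cons x w ih => rw [splitSum_cons, ih, List.length_cons, Finset.sum_range_succ' _ (w.length + 1), add_comm]; rfl

/-- Shuffling permutes lower entries and a contraction drops one of them. This lets formulas valid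
only at independent words be used under `quasiSum`. -/
theorem quasiSum_congr {κ : ℕ} : ∀ {ω η : MouldWord Γ L} {F F' : MouldWord Γ L → L},
    (∀ u : MouldWord Γ L, (u.map Prod.snd).Subperm ((ω ++ η).map Prod.snd) → F u = F' u) →
    quasiSum κ ω η F = quasiSum κ ω η F'
  | [], η, F, F', h => by simpa using h η (List.Subperm.refl _)
  | a :: ω, [], F, F', h => by simpa using h (a :: ω) (by rw [List.append_nil])
  | a :: ω, b :: η, F, F', h => by
    have hb : ∀ u : MouldWord Γ L, (u.map Prod.snd).Subperm ((a :: ω ++ η).map Prod.snd) →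
        (b.2 :: u.map Prod.snd).Subperm ((a :: ω ++ b :: η).map Prod.snd) := fun u hu =>
      ((List.subperm_cons _).2 hu).trans (by
        simpa using (List.perm_middle (a := b.2) (l₁ := a.2 :: ω.map Prod.snd)
          (l₂ := η.map Prod.snd)).symm.subperm)
    rw [quasiSum_cons_cons, quasiSum_cons_cons]
    congr 1
    · congr 1
      · refine quasiSum_congr fun u hu => h _ ?_
        simpa [List.subperm_cons] using hu
      · exact quasiSum_congr fun u hu => h _ (hb u hu)
    · congr 2
      · refine quasiSum_congr fun u hu => h _ ?_
        have : (ω.map Prod.snd ++ η.map Prod.snd).Subperm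
            (ω.map Prod.snd ++ b.2 :: η.map Prod.snd) :=
          ((List.sublist_cons_self _ _).append_left _).subperm
        simpa [List.subperm_cons] using (List.map_append ▸ hu).trans this
      · refine quasiSum_congr fun u hu => h _ (hb u (hu.trans (by simpa using (List.sublist_cons_self _ _).subperm)))
termination_by ω η => ω.length + η.length

/-- A merged letter keeps the lower entry of its left member, so lower rows only lose entries, and
no word produced is empty. -/
theorem blockSum_congr {x : Γ × L} {w : MouldWord Γ L} {F F' : MouldWord Γ L → L}
    (h : ∀ y u, ((y :: u).map Prod.snd).Sublist ((x :: w).map Prod.snd) →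
      F (y :: u) = F' (y :: u)) : blockSum x w F = blockSum x w F' := by
  induction w generalizing x F F' with
  | nil => exact h _ _ (by simp)
  | cons z w ih =>
    have h1 : blockSum z w (fun u => F (x :: u)) = blockSum z w fun u => F' (x :: u) :=
      ih fun y u hu => h _ _ (by simpa using hu)
    have h2 : blockSum (x.1 * z.1, x.2) w F = blockSum (x.1 * z.1, x.2) w F' :=
      ih fun y u hu => h _ _ (hu.trans (by simp))
    rw [blockSum_cons, blockSum_cons, h1, h2]

theorem ganitSum_congr {w : MouldWord Γ L} {F F' : MouldWord Γ L → L}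
    (h : ∀ u : MouldWord Γ L, (u.map Prod.snd).Sublist (w.map Prod.snd) → (w ≠ [] → u ≠ []) →
      F u = F' u) : ganitSum w F = ganitSum w F' := by
  cases w with
  | nil => exact h [] (by simp) (by simp)
  | cons x w => exact blockSum_congr fun y u hu => h _ hu (by simp)

/-! ### Coproducts -/

/-- Deconcatenation is multiplicative for the quasi-shuffle products. -/
theorem quasiSum_splitSum (κ : ℕ) : ∀ (ω η : MouldWord Γ L)
    (Φ : MouldWord Γ L → MouldWord Γ L → L),
    quasiSum κ ω η (fun u => splitSum u Φ) =
      splitSum ω fun ω₁ ω₂ => splitSum η fun η₁ η₂ =>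
        quasiSum κ ω₁ η₁ fun u => quasiSum κ ω₂ η₂ (Φ u)
  | [], η, Φ => by simp
  | a :: ω, [], Φ => by simp
  | a :: ω, b :: η, Φ => by
    have h1 := quasiSum_splitSum κ ω (b :: η)
    have h2 := quasiSum_splitSum κ (a :: ω) η
    have h3 := quasiSum_splitSum κ ω η
    simp only [splitSum_cons, quasiSum_nil_left, quasiSum_nil_right, map_fun_add, splitSum_fun_add,
      quasiSum_cons_cons, splitSum_fun_sub, splitSum_fun_mul, h1, h2, h3]
      at *
    ring
termination_by ω η => ω.length + η.length

/-- `ganitSum` is compatible with deconcatenation. -/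
theorem blockSum_splitSum (x : Γ × L) (w : MouldWord Γ L)
    (Φ : MouldWord Γ L → MouldWord Γ L → L) :
    blockSum x w (fun u => splitSum u Φ) = blockSum x w (Φ []) +
      splitSum w fun c w' => blockSum x c fun u => ganitSum w' (Φ u) := by
  induction w generalizing x Φ with
  | nil => simp
  | cons y w ih =>
    simp only [blockSum_cons, splitSum_cons, map_fun_add, ih, splitSum_fun_add, splitSum_fun_mul,
      blockSum_nil, ganitSum_cons]
    ring

theorem ganitSum_splitSum (w : MouldWord Γ L) (Φ : MouldWord Γ L → MouldWord Γ L → L) :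
    ganitSum w (fun u => splitSum u Φ) =
      splitSum w fun c w' => ganitSum c fun u => ganitSum w' (Φ u) := by
  cases w with
  | nil => simp
  | cons x w => simp [blockSum_splitSum]

/-- The terms are sorted by the string `c` of letters absorbed into `x`; what follows `c` is
decomposed freely. -/
theorem blockSum_eq_splitSum (x : Γ × L) (w : MouldWord Γ L) (F : MouldWord Γ L → L) :
    blockSum x w F = splitSum w fun c w' =>
      polarWeight x.2 c * ganitSum w' fun u => F ((x.1 * upperProd c, x.2) :: u) := by
  induction w generalizing x F with
  | nil => simp
  | cons y w ih =>
    rw [blockSum_cons, splitSum_cons, ih (x.1 * y.1, x.2)]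
    simp [mul_assoc, splitSum_fun_mul]

theorem blockSum_comm (x : Γ × L) (w : MouldWord Γ L) (T : (MouldWord Γ L → L) →ₗ[L] L)
    (Φ : MouldWord Γ L → MouldWord Γ L → L) :
    blockSum x w (fun u => T (Φ u)) = T fun v => blockSum x w fun u => Φ u v := by
  induction w generalizing x Φ with
  | nil => rfl
  | cons y w ih => simp only [blockSum_cons, ih, map_fun_add, map_fun_mul]

/-! ### `ganit pic` intertwines the products `ш_*` and `ш` -/

/-- `polarWeight x` is a character of the product `ш_*`. -/
theorem quasiSum_one_polarWeight (x : L) : ∀ (ω η : MouldWord Γ L) (K : Γ → L),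
    x ∉ ω.map Prod.snd → x ∉ η.map Prod.snd → (ω.map Prod.snd).Disjoint (η.map Prod.snd) →
    quasiSum 1 ω η (fun u => polarWeight x u * K (upperProd u)) =
      polarWeight x ω * polarWeight x η * K (upperProd ω * upperProd η)
  | [], η, K, _, _, _ => by simp
  | a :: ω, [], K, _, _, _ => by simp
  | a :: ω, b :: η, K, ha, hb, hd => by
    simp only [List.map_cons, List.mem_cons, not_or, List.disjoint_cons_left,
      List.disjoint_cons_right] at ha hb hd
    obtain ⟨ha1, ha2⟩ := ha
    obtain ⟨hb1, hb2⟩ := hb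
    obtain ⟨⟨hab, h1⟩, h2, h3⟩ := hd
    -- Each split-off upper entry is moved into `K` by translation; commutativity of `Γ` makes all
    -- terms end at the same value of `K`.
    have e1 := quasiSum_one_polarWeight x ω (b :: η) (fun g => K (a.1 * g)) ha2
      (by rw [List.map_cons, List.mem_cons]; tauto)
      (by rw [List.map_cons, List.disjoint_cons_right]; tauto)
    have e2 := quasiSum_one_polarWeight x (a :: ω) η (fun g => K (b.1 * g)) (by rw [List.map_cons, List.mem_cons]; tauto)
      hb2 (by rw [List.map_cons, List.disjoint_cons_left]; tauto)
    have e3 := quasiSum_one_polarWeight x ω η (fun g => K (a.1 * b.1 * g)) ha2 hb2 h3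
    have g1 : a.1 * (upperProd ω * (b.1 * upperProd η)) =
        a.1 * upperProd ω * (b.1 * upperProd η) := by rw [mul_assoc]
    have g2 : b.1 * (a.1 * upperProd ω * upperProd η) =
        a.1 * upperProd ω * (b.1 * upperProd η) := by ac_rfl
    have g3 : a.1 * b.1 * (upperProd ω * upperProd η) =
        a.1 * upperProd ω * (b.1 * upperProd η) := by ac_rfl
    simp only [polarWeight_cons, upperProd_cons, g1, g2, g3] at e1 e2 e3
    simp only [quasiSum_cons_cons, polarWeight_cons, upperProd_cons, mul_assoc, map_fun_mul]
      at e1 e2 e3 ⊢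
    rw [e1, e2, e3]
    -- With A = 1/(a - x) and B = 1/(b - x), the claim is AB + AB + (A - B)/(a - b) = AB.
    have n1 : a.2 - x ≠ 0 := sub_ne_zero.2 (Ne.symm ha1)
    have n2 : b.2 - x ≠ 0 := sub_ne_zero.2 (Ne.symm hb1)
    have n3 : a.2 - b.2 ≠ 0 := sub_ne_zero.2 (by tauto)
    field_simp
    push_cast
    ring
termination_by ω η => ω.length + η.length

/-- The value of `F` at the shuffle product of the images of two words under `ganitSum`. -/
def ganitShuffle (ω η : MouldWord Γ L) (F : MouldWord Γ L → L) : L :=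
  ganitSum ω fun u => ganitSum η fun v => quasiSum 0 u v F

/-- The common expansion of both sides of `quasiSum_one_ganitSum`, along the words which start
with the letter `x`. -/
def crossSum (x : Γ × L) (ω η : MouldWord Γ L) (F : MouldWord Γ L → L) : L :=
  splitSum ω fun ω₁ ω₂ => splitSum η fun η₁ η₂ =>
    polarWeight x.2 ω₁ * polarWeight x.2 η₁ *
      ganitShuffle ω₂ η₂ fun u => F ((x.1 * (upperProd ω₁ * upperProd η₁), x.2) :: u)

/-- Once the string absorbed into `x` is cut off, deconcatenation distributes over ш_*: the
character property handles the prefixes and `ih` the suffixes. -/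
theorem quasiSum_one_blockSum (x : Γ × L) (ω η : MouldWord Γ L) (F : MouldWord Γ L → L)
    (hx : x.2 ∉ ω.map Prod.snd) (hx' : x.2 ∉ η.map Prod.snd)
    (hd : (ω.map Prod.snd).Disjoint (η.map Prod.snd))
    (ih : ∀ (ω₂ η₂ : MouldWord Γ L) (F : MouldWord Γ L → L), ω₂ <:+ ω → η₂ <:+ η →
      quasiSum 1 ω₂ η₂ (fun u => ganitSum u F) = ganitShuffle ω₂ η₂ F) :
    quasiSum 1 ω η (fun u => blockSum x u F) = crossSum x ω η F := by
  simp only [blockSum_eq_splitSum]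
  rw [quasiSum_splitSum, crossSum]
  refine splitSum_congr fun ω₁ ω₂ hω => splitSum_congr fun η₁ η₂ hη => ?_
  simp only [map_fun_mul]
  subst hω hη
  simp only [List.map_append, List.mem_append, not_or, List.disjoint_append_left,
    List.disjoint_append_right] at hx hx' hd
  have e : ∀ u : MouldWord Γ L,
      quasiSum 1 ω₂ η₂ (fun w => ganitSum w fun v => F ((x.1 * upperProd u, x.2) :: v)) =
        ganitShuffle ω₂ η₂ fun v => F ((x.1 * upperProd u, x.2) :: v) := fun u =>
    ih _ _ _ (List.suffix_append _ _) (List.suffix_append _ _)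
  simp only [e]
  exact quasiSum_one_polarWeight x.2 ω₁ η₁
    (fun g => ganitShuffle ω₂ η₂ fun v => F ((x.1 * g, x.2) :: v)) hx.1 hx'.1 hd.1.1

/-- Either the prefix taken from `b :: η` is empty, or it starts with `b`, which then merges into
the leading letter. -/
theorem crossSum_cons_right (a b : Γ × L) (ω η : MouldWord Γ L) (F : MouldWord Γ L → L) :
    crossSum a ω (b :: η) F = (splitSum ω fun ω₁ ω₂ => polarWeight a.2 ω₁ *
        ganitShuffle ω₂ (b :: η) fun u => F ((a.1 * upperProd ω₁, a.2) :: u)) +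
      (b.2 - a.2)⁻¹ * crossSum (a.1 * b.1, a.2) ω η F := by
  simp only [crossSum, splitSum_cons, splitSum_fun_add, polarWeight_nil, upperProd_nil, mul_one,
    ← splitSum_fun_mul, polarWeight_cons, upperProd_cons]
  congr 1
  refine splitSum_congr fun ω₁ ω₂ _ => splitSum_congr fun η₁ η₂ _ => ?_
  have g : a.1 * (upperProd ω₁ * (b.1 * upperProd η₁)) =
    a.1 * b.1 * (upperProd ω₁ * upperProd η₁) := by ac_rfl
  rw [g]
  ring

theorem crossSum_cons_left (a b : Γ × L) (ω η : MouldWord Γ L) (F : MouldWord Γ L → L) :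
    crossSum b (a :: ω) η F = (splitSum η fun η₁ η₂ => polarWeight b.2 η₁ *
        ganitShuffle (a :: ω) η₂ fun u => F ((b.1 * upperProd η₁, b.2) :: u)) +
      (a.2 - b.2)⁻¹ * crossSum (a.1 * b.1, b.2) ω η F := by
  simp only [crossSum, splitSum_cons, polarWeight_nil, upperProd_nil, one_mul,
    ← splitSum_fun_mul, polarWeight_cons, upperProd_cons]
  congr 1
  refine splitSum_congr fun ω₁ ω₂ _ => splitSum_congr fun η₁ η₂ _ => ?_
  have g : b.1 * (a.1 * upperProd ω₁ * upperProd η₁) =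
    a.1 * b.1 * (upperProd ω₁ * upperProd η₁) := by ac_rfl
  rw [g]
  ring

/-- A shuffle of two nonempty words begins with the first letter of one of them, and that letter is
`a` or `b` with an absorbed prefix. -/
theorem ganitShuffle_cons_cons (a b : Γ × L) (ω η : MouldWord Γ L) (F : MouldWord Γ L → L) :
    ganitShuffle (a :: ω) (b :: η) F =
      (splitSum ω fun ω₁ ω₂ => polarWeight a.2 ω₁ *
        ganitShuffle ω₂ (b :: η) fun u => F ((a.1 * upperProd ω₁, a.2) :: u)) +
      splitSum η fun η₁ η₂ => polarWeight b.2 η₁ *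
        ganitShuffle (a :: ω) η₂ fun u => F ((b.1 * upperProd η₁, b.2) :: u) := by
  simp only [ganitShuffle, ganitSum_cons]
  have comm : ∀ (y : Γ × L) (w : MouldWord Γ L) (Φ : MouldWord Γ L → MouldWord Γ L → L),
      (blockSum a ω fun u => blockSum y w fun v => Φ u v) =
        blockSum y w fun v => blockSum a ω fun u => Φ u v := fun y w Φ => blockSum_comm _ _ _ _
  have comm' : ∀ (w : MouldWord Γ L) (Φ : MouldWord Γ L → MouldWord Γ L → L),
      (blockSum a ω fun u => ganitSum w fun v => Φ u v) =
        ganitSum w fun v => blockSum a ω fun u => Φ u v := fun w Φ => blockSum_comm _ _ _ _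
  -- All words `u`, `v` occurring are nonempty, so the defaults of `headD` play no role.
  have e : (blockSum a ω fun u => blockSum b η fun v => quasiSum 0 u v F) =
      blockSum a ω fun u => blockSum b η fun v =>
        quasiSum 0 u.tail v (fun t => F (u.headD a :: t)) +
          quasiSum 0 u v.tail (fun t => F (v.headD b :: t)) := by
    refine blockSum_congr fun A u _ => blockSum_congr fun B v _ => ?_
    simp [quasiSum_cons_cons]
  rw [e]
  simp only [map_fun_add]
  congr 1
  · rw [blockSum_eq_splitSum]
    rfl
  · rw [comm, blockSum_eq_splitSum]
    refine splitSum_congr fun η₁ η₂ _ => ?_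
    rw [comm']
    rfl

/-- `ganitSum` is a homomorphism from the product `ш_*` to the shuffle product. -/
theorem quasiSum_one_ganitSum : ∀ (ω η : MouldWord Γ L) (F : MouldWord Γ L → L),
    (ω.map Prod.snd ++ η.map Prod.snd).Nodup →
    quasiSum 1 ω η (fun u => ganitSum u F) = ganitShuffle ω η F
  | [], η, F, _ => by simp [ganitShuffle]
  | a :: ω, [], F, _ => by simp [ganitShuffle]
  | a :: ω, b :: η, F, h => by
    have ih : ∀ ω₂ η₂ : MouldWord Γ L, ω₂ <:+ a :: ω → η₂ <:+ b :: η →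
        ω₂.length + η₂.length < (a :: ω).length + (b :: η).length → ∀ F : MouldWord Γ L → L,
        quasiSum 1 ω₂ η₂ (fun u => ganitSum u F) = ganitShuffle ω₂ η₂ F :=
      fun ω₂ η₂ h1 h2 _ F => quasiSum_one_ganitSum ω₂ η₂ F
        (h.sublist ((h1.sublist.map _).append (h2.sublist.map _)))
    simp only [List.map_cons, List.nodup_append, List.nodup_cons, List.mem_cons] at h
    obtain ⟨⟨ha, -⟩, ⟨hb, -⟩, hne⟩ := h
    have hab : a.2 ≠ b.2 := hne _ (Or.inl rfl) _ (Or.inl rfl)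
    have ha' : a.2 ∉ η.map Prod.snd := fun h => hne _ (Or.inl rfl) _ (Or.inr h) rfl
    have hb' : b.2 ∉ ω.map Prod.snd := fun h => hne _ (Or.inr h) _ (Or.inl rfl) rfl
    have hd : (ω.map Prod.snd).Disjoint (η.map Prod.snd) := fun x h1 h2 =>
      hne _ (Or.inr h1) _ (Or.inr h2) rfl
    have sω : ∀ w, w <:+ ω → w <:+ a :: ω := fun w hw => hw.trans (List.suffix_cons _ _)
    have sη : ∀ w, w <:+ η → w <:+ b :: η := fun w hw => hw.trans (List.suffix_cons _ _)
    simp only [quasiSum_cons_cons, ganitSum_cons]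
    rw [quasiSum_one_blockSum a ω (b :: η) F ha
        (by rw [List.map_cons, List.mem_cons]; tauto)
        (by rw [List.map_cons, List.disjoint_cons_right]; tauto) fun ω₂ η₂ F h1 h2 =>
          ih ω₂ η₂ (sω _ h1) h2
            (by have := h1.length_le; have := h2.length_le; simp at *; omega) F,
      quasiSum_one_blockSum b (a :: ω) η F
        (by rw [List.map_cons, List.mem_cons]; tauto) hb
        (by rw [List.map_cons, List.disjoint_cons_left]; tauto) fun ω₂ η₂ F h1 h2 =>
          ih ω₂ η₂ h1 (sη _ h2)
            (by have := h1.length_le; have := h2.length_le; simp at *; omega) F,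
      quasiSum_one_blockSum (a.1 * b.1, a.2) ω η F ha ha' hd fun ω₂ η₂ F h1 h2 =>
          ih ω₂ η₂ (sω _ h1) (sη _ h2)
            (by have := h1.length_le; have := h2.length_le; simp at *; omega) F,
      quasiSum_one_blockSum (a.1 * b.1, b.2) ω η F hb' hb hd fun ω₂ η₂ F h1 h2 =>
          ih ω₂ η₂ (sω _ h1) (sη _ h2)
            (by have := h1.length_le; have := h2.length_le; simp at *; omega) F,
      crossSum_cons_right, crossSum_cons_left, ganitShuffle_cons_cons,
      show (b.2 - a.2)⁻¹ = -(a.2 - b.2)⁻¹ by rw [← inv_neg, neg_sub]]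
    -- The merging terms of the two `crossSum` expansions cancel the two contraction terms, leaving
    -- the expansion of `ganitShuffle`.
    push_cast
    ring
termination_by ω η => ω.length + η.length

end Combinatorics
end Mould

/-! ### Substitution into rational functions -/

namespace RatField

variable {ι K L : Type} [Field K] [Algebra ℚ K] [Field L] [Algebra ℚ L]

/-- `RatField.subst` as a field embedding. -/
def substHom {y : ι → L} (h : AlgebraicIndependent ℚ y) : RatField ι →ₐ[ℚ] L :=
  IsFractionRing.liftAlgHom (K := RatField ι) (g := MvPolynomial.aeval y)
    (algebraicIndependent_iff_injective_aeval.1 h)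

theorem subst_eq {y : ι → L} (h : AlgebraicIndependent ℚ y) (f : RatField ι) :
    subst y f = substHom h f := dif_pos h

theorem subst_of_not {y : ι → L} (h : ¬ AlgebraicIndependent ℚ y) (f : RatField ι) :
    subst y f = 0 := dif_neg h

theorem substHom_algebraMap {y : ι → L} (h : AlgebraicIndependent ℚ y) (p : MvPolynomial ι ℚ) :
    substHom h (algebraMap _ _ p) = MvPolynomial.aeval y p :=
  IsFractionRing.lift_algebraMap (algebraicIndependent_iff_injective_aeval.1 h) p

@[simp] theorem substHom_var {y : ι → L} (h : AlgebraicIndependent ℚ y) (i : ι) :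
    substHom h (var i) = y i := by
  rw [var, substHom_algebraMap, MvPolynomial.aeval_X]

theorem algHom_ext' {f g : RatField ι →ₐ[ℚ] L} (h : ∀ i, f (var i) = g (var i)) : f = g := by
  refine IsLocalization.algHom_ext (nonZeroDivisors (MvPolynomial ι ℚ)) ?_
  exact MvPolynomial.algHom_ext h

theorem algebraicIndependent_var (ι : Type) :
    AlgebraicIndependent ℚ (var : ι → RatField ι) :=
  (MvPolynomial.algebraicIndependent_X ι ℚ).map'
    (f := IsScalarTower.toAlgHom ℚ (MvPolynomial ι ℚ) (RatField ι))
    (IsFractionRing.injective (MvPolynomial ι ℚ) (RatField ι))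

theorem subst_var_self (f : RatField ι) : subst var f = f := by
  rw [subst_eq (algebraicIndependent_var ι),
    algHom_ext' (g := AlgHom.id ℚ _) fun i => substHom_var (algebraicIndependent_var ι) i]
  rfl

/-- A field embedding preserves and reflects algebraic independence, so the dummy value 0 appears on
both sides or on neither. -/
theorem map_subst (φ : K →ₐ[ℚ] L) (y : ι → K) (f : RatField ι) :
    φ (subst y f) = subst (fun i => φ (y i)) f := by
  have hφ : AlgebraicIndependent ℚ (fun i => φ (y i)) ↔ AlgebraicIndependent ℚ y :=
    φ.algebraicIndependent_iff φ.injective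
  by_cases h : AlgebraicIndependent ℚ y
  · rw [subst_eq h, subst_eq (hφ.2 h), ← AlgHom.comp_apply]
    congr 1
    refine algHom_ext' fun i => ?_
    rw [AlgHom.comp_apply, substHom_var, substHom_var]
  · rw [subst_of_not h, subst_of_not (mt hφ.1 h), map_zero]

theorem subst_zero (y : ι → L) : subst y (0 : RatField ι) = 0 := by
  by_cases h : AlgebraicIndependent ℚ y
  · rw [subst_eq h, map_zero]
  · rw [subst_of_not h]

end RatField

/-! ### Values of moulds at algebraically independent words -/

namespace Mould

section Eval

set_option linter.unusedSectionVars false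

variable {Γ : Type*} [CommGroup Γ] {K L : Type} [Field K] [Algebra ℚ K] [Field L] [Algebra ℚ L]

/-- Apply a map to the lower entries of a word. -/
def mapWord (φ : K → L) (w : MouldWord Γ K) : MouldWord Γ L := w.map (Prod.map id φ)

@[simp] theorem mapWord_nil (φ : K → L) : mapWord (Γ := Γ) φ [] = [] := rfl

@[simp] theorem mapWord_cons (φ : K → L) (x : Γ × K) (w : MouldWord Γ K) :
    mapWord φ (x :: w) = (x.1, φ x.2) :: mapWord φ w := rfl

@[simp] theorem length_mapWord (φ : K → L) (w : MouldWord Γ K) :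
    (mapWord φ w).length = w.length := List.length_map _

theorem mapWord_append (φ : K → L) (v w : MouldWord Γ K) :
    mapWord φ (v ++ w) = mapWord φ v ++ mapWord φ w := List.map_append

/-- The lower entries of a word are algebraically independent over `ℚ`. -/
def Indep (w : MouldWord Γ L) : Prop :=
  AlgebraicIndependent ℚ fun i : Fin w.length => (w.get i).2

theorem Indep.nodup {w : MouldWord Γ L} (h : Indep w) : (w.map Prod.snd).Nodup := by
  rw [List.nodup_iff_injective_get]
  have := h.injective
  intro i j hij
  have := @this (i.cast (by simp)) (j.cast (by simp)) (by simpa using hij)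
  simpa [Fin.ext_iff] using this

theorem indep_iff {w : MouldWord Γ L} : Indep w ↔ (w.map Prod.snd).Nodup ∧
    AlgebraicIndependent ℚ (Subtype.val : {x | x ∈ w.map Prod.snd} → L) := by
  have hr : Set.range (fun i : Fin w.length => (w.get i).2) = {x | x ∈ w.map Prod.snd} := by
    ext x
    simp [List.mem_iff_get, Fin.exists_iff]
  constructor
  · intro h
    refine ⟨h.nodup, ?_⟩
    rw [← hr]
    exact (algebraicIndependent_subtype_range h.injective).2 h
  · rintro ⟨h1, h2⟩
    rw [← hr] at h2
    refine (algebraicIndependent_subtype_range fun i j hij => ?_).1 h2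
    have := List.nodup_iff_injective_get.1 h1 (a₁ := i.cast (by simp)) (a₂ := j.cast (by simp))
      (by simpa using hij)
    simpa [Fin.ext_iff] using this

theorem Indep.of_subperm {v w : MouldWord Γ L} (h : Indep w)
    (hv : (v.map Prod.snd).Subperm (w.map Prod.snd)) : Indep v := by
  rw [indep_iff] at h ⊢
  obtain ⟨l, hl, hlw⟩ := hv
  exact ⟨hl.nodup_iff.1 (h.1.sublist hlw), h.2.mono fun x hx => hlw.subset (hl.mem_iff.2 hx)⟩

theorem Indep.of_sublist {v w : MouldWord Γ L} (h : Indep w) (hv : v.Sublist w) : Indep v :=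
  h.of_subperm (hv.map _).subperm

theorem indep_nil : Indep ([] : MouldWord Γ L) := by
  have : IsEmpty (Fin ([] : MouldWord Γ L).length) := Fin.isEmpty'
  exact (algebraicIndependent_empty_type_iff ..).2 (algebraMap ℚ L).injective

theorem eval_of_length (M : Mould Γ) (w : MouldWord Γ L) {n : ℕ} (h : w.length = n) :
    M.eval w = RatField.subst (fun i : Fin n => (w.get (i.cast h.symm)).2)
      (M n fun i => (w.get (i.cast h.symm)).1) := by
  subst h; rfl

theorem map_eval (φ : K →ₐ[ℚ] L) (M : Mould Γ) (w : MouldWord Γ K) :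
    φ (M.eval w) = M.eval (mapWord φ w) := by
  rw [eval, RatField.map_subst, eval_of_length M (mapWord φ w) (length_mapWord _ _)]
  congr 1 <;> simp only [mapWord, List.get_eq_getElem, List.getElem_map] <;> rfl

theorem eval_genericWord (M : Mould Γ) {m : ℕ} (σ : Fin m → Γ) :
    M.eval (genericWord σ) = M m σ := by
  rw [eval_of_length M (genericWord σ) (n := m) (by simp [genericWord])]
  conv_rhs => rw [← RatField.subst_var_self (M m σ)]
  congr 1 <;> simp only [genericWord, List.get_ofFn] <;> rfl

theorem indep_ofFn {m : ℕ} {σ : Fin m → Γ} {y : Fin m → L} (h : AlgebraicIndependent ℚ y) :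
    Indep (List.ofFn fun i => (σ i, y i)) := by
  have e : (fun i : Fin (List.ofFn fun i => (σ i, y i)).length =>
      ((List.ofFn fun i => (σ i, y i)).get i).2) = y ∘ Fin.cast (List.length_ofFn) := by
    funext i
    rw [List.get_ofFn]
    rfl
  rw [Indep, e]
  exact h.comp _ (Fin.cast_injective _)

theorem indep_genericWord {m : ℕ} (σ : Fin m → Γ) : Indep (genericWord σ) :=
  indep_ofFn (RatField.algebraicIndependent_var _)

theorem map_eq_ofFn {α β : Type*} (f : α → β) (w : List α) :
    w.map f = List.ofFn fun i : Fin w.length => f (w.get i) := by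
  conv_lhs => rw [← List.ofFn_get w]
  exact List.map_ofFn

/-- This reduces the evaluation formulas to generic words, where the operations on moulds are
defined. -/
theorem Indep.exists_mapWord {w : MouldWord Γ L} (h : Indep w) :
    ∃ (m : ℕ) (σ : Fin m → Γ) (φ : RatField (Fin m) →ₐ[ℚ] L), mapWord φ (genericWord σ) = w := by
  refine ⟨w.length, fun i => (w.get i).1,
    RatField.substHom (y := fun i : Fin w.length => (w.get i).2) h, ?_⟩
  rw [mapWord, genericWord, List.map_ofFn]
  conv_rhs => rw [← List.ofFn_get w]
  congr 1
  funext i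
  exact Prod.ext rfl (RatField.substHom_var _ i)

theorem ext_eval {M N : Mould Γ} (h : ∀ (m : ℕ) (σ : Fin m → Γ),
    M.eval (genericWord σ) = N.eval (genericWord σ)) : M = N := by
  funext m σ
  rw [← eval_genericWord M, h, eval_genericWord]

/-- The substitution X_i ↦ X_{i+1} - X_0 of polynomial rings is injective, being split by X_0 ↦ 0,
X_{i+1} ↦ X_i. It makes `pic` meaningful at flexed words. -/
theorem Indep.shift {x : Γ × L} {w : MouldWord Γ L} (h : Indep (x :: w)) :
    Indep (w.map fun y => (y.1, y.2 - x.2)) := by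
  have hx : AlgebraicIndependent ℚ fun i : Fin w.length => (w.get i).2 - x.2 := by
    rw [algebraicIndependent_iff_injective_aeval] at *
    let θ : MvPolynomial (Fin w.length) ℚ →ₐ[ℚ] MvPolynomial (Fin (w.length + 1)) ℚ :=
      MvPolynomial.aeval fun i => MvPolynomial.X i.succ - MvPolynomial.X 0
    let ψ : MvPolynomial (Fin (w.length + 1)) ℚ →ₐ[ℚ] MvPolynomial (Fin w.length) ℚ :=
      MvPolynomial.aeval (Fin.cons 0 MvPolynomial.X)
    have hψ : ψ.comp θ = AlgHom.id ℚ _ := by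
      refine MvPolynomial.algHom_ext fun i => ?_
      simp [ψ, θ]
    have hθ : Function.Injective θ := Function.LeftInverse.injective (g := ψ) fun p =>
      DFunLike.congr_fun hψ p
    have e : MvPolynomial.aeval (R := ℚ) (fun i : Fin w.length => (w.get i).2 - x.2) =
        (MvPolynomial.aeval fun i : Fin (w.length + 1) => ((x :: w).get i).2).comp θ := by
      refine MvPolynomial.algHom_ext fun i => ?_
      simp [θ]
    rw [e]
    exact (algebraicIndependent_iff_injective_aeval.1 h).comp hθ
  have e : (w.map fun y => (y.1, y.2 - x.2)) =
      List.ofFn fun i : Fin w.length => ((w.get i).1, (w.get i).2 - x.2) :=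
    map_eq_ofFn _ w
  rw [e]
  exact indep_ofFn hx

/-! ### Values of products, powers and exponentials -/

theorem eval_mul (A B : Mould Γ) {w : MouldWord Γ L} (h : Indep w) :
    (mul A B).eval w = splitSum w fun c w' => A.eval c * B.eval w' := by
  obtain ⟨m, σ, φ, rfl⟩ := h.exists_mapWord
  rw [← map_eval, eval_genericWord, mul, splitSum_eq_sum_range, map_sum]
  simp [genericWord, map_eval, mapWord, List.map_take, List.map_drop]

theorem eval_unit {w : MouldWord Γ L} (h : Indep w) :
    (unit : Mould Γ).eval w = if w = [] then 1 else 0 := by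
  rw [eval, RatField.subst_eq h, unit]
  rcases w with _ | ⟨x, w⟩ <;> simp

theorem eval_nil_of_mem_ARI {A : Mould Γ} (hA : A ∈ ARI Γ) :
    A.eval ([] : MouldWord Γ L) = 0 := by
  have : A 0 (fun i : Fin 0 => (([] : MouldWord Γ L).get i).1) = 0 := by
    rw [← hA]; congr 1; exact Subsingleton.elim _ _
  rw [eval]
  exact (congrArg _ this).trans (RatField.subst_zero _)

theorem apply_zero_eq_eval (A : Mould Γ) : A 0 ![] = A.eval (genericWord ![]) :=
  (eval_genericWord A _).symm

theorem eval_pow_succ (A : Mould Γ) (k : ℕ) {w : MouldWord Γ L} (h : Indep w) :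
    (A.pow (k + 1)).eval w = splitSum w fun c w' => (A.pow k).eval c * A.eval w' :=
  eval_mul _ _ h

/-- Each of the k factors must receive at least one letter, as A(∅) = 0. -/
theorem eval_pow_eq_zero {A : Mould Γ} (hA : A ∈ ARI Γ) {k : ℕ} {w : MouldWord Γ L}
    (h : Indep w) (hk : w.length < k) : (A.pow k).eval w = 0 := by
  induction k generalizing w with
  | zero => omega
  | succ k ih =>
    rw [eval_pow_succ A k h, splitSum_eq_sum_range]
    refine Finset.sum_eq_zero fun i _ => ?_
    rcases lt_or_ge i w.length with hi | hi
    · rw [ih (h.of_sublist (List.take_sublist _ _)) (by simp; omega), zero_mul]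
    · rw [List.drop_eq_nil_of_le hi, eval_nil_of_mem_ARI hA, mul_zero]

/-- The free bound `N` allows one common truncation for words of different lengths. -/
theorem eval_expTimes {A : Mould Γ} (hA : A ∈ ARI Γ) {w : MouldWord Γ L} (h : Indep w) {N : ℕ}
    (hN : w.length < N) : (expTimes A).eval w =
      ∑ k ∈ Finset.range N, ((k.factorial : L))⁻¹ * (A.pow k).eval w := by
  obtain ⟨m, σ, φ, rfl⟩ := h.exists_mapWord
  rw [← map_eval, eval_genericWord, expTimes,
    finsum_eq_sum_of_support_subset (s := Finset.range N), map_sum]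
  · simp [← map_eval, eval_genericWord]
  · intro k hk
    by_contra hk'
    simp only [Finset.coe_range, Set.mem_Iio, not_lt] at hk'
    refine hk ?_
    simp only
    rw [← eval_genericWord (A.pow k), eval_pow_eq_zero hA (indep_genericWord σ), mul_zero]
    rw [length_mapWord] at hN
    omega

/-! ### The decomposition sum as `ganitSum` -/

theorem eval_pic {w : MouldWord Γ L} (h : Indep w) :
    (pic : Mould Γ).eval w = (w.map fun y => y.2⁻¹).prod := by
  have h' : AlgebraicIndependent ℚ fun i : Fin w.length => (w.get i).2 := h
  rw [eval, RatField.subst_eq h', pic, map_inv₀, map_prod, map_eq_ofFn, List.prod_ofFn,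
    ← Finset.prod_inv_distrib]
  simp only [RatField.substHom_var]

theorem isDecomp_nil {α : Type*} {w : List α} : IsDecomp w [] ↔ w = [] := by
  simp [IsDecomp, eq_comm]

theorem isDecomp_cons {α : Type*} {w a b : List α} {d : List (List α × List α)} :
    IsDecomp w ((a, b) :: d) ↔
      a ≠ [] ∧ (d = [] ∨ b ≠ []) ∧ ∃ w', w = a ++ (b ++ w') ∧ IsDecomp w' d := by
  rcases d with _ | ⟨c, d⟩
  · simp [IsDecomp, eq_comm, and_comm]
  · constructor
    · rintro ⟨h1, h2, h3⟩
      refine ⟨h2 (a, b) (by simp), Or.inr (h3 (a, b) (by simp)),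
        ((c :: d).map fun c => c.1 ++ c.2).flatten, h1.symm.trans (by simp), rfl, fun e he => h2 e (List.mem_cons_of_mem _ he), fun e he => h3 e ?_⟩
      rw [List.dropLast_cons_of_ne_nil (by simp)]
      exact List.mem_cons_of_mem _ he
    · rintro ⟨h1, h2, w', rfl, h3, h4, h5⟩
      refine ⟨by rw [List.map_cons, List.flatten_cons, h3]; simp, ?_, ?_⟩
      · intro c hc
        rcases List.mem_cons.1 hc with rfl | hc
        exacts [h1, h4 _ hc]
      · intro c hc
        rw [List.dropLast_cons_of_ne_nil (by simp)] at hc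
        rcases List.mem_cons.1 hc with rfl | hc
        exacts [by simpa using h2, h5 _ hc]

theorem mem_decomps {α : Type*} {w : List α} {d : List (List α × List α)} :
    d ∈ decomps w ↔ IsDecomp w d := by simp [decomps]

/-- Put a letter in front of the first block of a decomposition. -/
def consHead {α : Type*} (x : α) : List (List α × List α) → List (List α × List α)
  | [] => [([x], [])]
  | (a, b) :: d => (x :: a, b) :: d

/-- Either `x` extends the first block of a decomposition of `w`, or a₁ = [x] with b₁ nonempty. The
remaining case a₁ = [x], b₁ = ∅ forces `w = []` and is the empty case of `consHead`. -/
theorem isDecomp_cons_iff {α : Type*} {x : α} {w : List α} {d : List (List α × List α)} :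
    IsDecomp (x :: w) d ↔ (∃ e, IsDecomp w e ∧ consHead x e = d) ∨
      ∃ i < w.length, ∃ e, IsDecomp (w.drop (i + 1)) e ∧ ([x], w.take (i + 1)) :: e = d := by
  constructor
  · intro h
    rcases d with _ | ⟨⟨a, b⟩, d⟩
    · simp [isDecomp_nil] at h
    obtain ⟨ha, hb, w', hw, hd⟩ := isDecomp_cons.1 h
    obtain ⟨y, a, rfl⟩ := List.exists_cons_of_ne_nil ha
    obtain ⟨rfl, rfl⟩ := List.cons.inj hw
    rcases a with _ | ⟨z, a⟩
    · rcases b with _ | ⟨z, b⟩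
      · obtain rfl : d = [] := by simpa using hb
        obtain rfl := isDecomp_nil.1 hd
        exact Or.inl ⟨[], hd, rfl⟩
      · exact Or.inr ⟨b.length, by simp, d, by simpa using hd, by simp⟩
    · exact Or.inl ⟨(z :: a, b) :: d, isDecomp_cons.2 ⟨by simp, hb, w', rfl, hd⟩, rfl⟩
  · rintro (⟨e, he, rfl⟩ | ⟨i, hi, e, he, rfl⟩)
    · rcases e with _ | ⟨⟨a, b⟩, e⟩
      · obtain rfl := isDecomp_nil.1 he
        exact isDecomp_cons.2 ⟨by simp, by simp, [], by simp, he⟩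
      · obtain ⟨-, hb, w', rfl, he'⟩ := isDecomp_cons.1 he
        exact isDecomp_cons.2 ⟨by simp, hb, w', rfl, he'⟩
    · refine isDecomp_cons.2 ⟨by simp, Or.inr ?_, _, ?_, he⟩
      · intro h0
        have := congrArg List.length h0
        simp only [List.length_take, List.length_nil] at this
        omega
      · simp

theorem consHead_injOn {α : Type*} (x : α) (w : List α) :
    Set.InjOn (consHead x) {d | IsDecomp w d} := by
  intro d hd e he hde
  rcases d with _ | ⟨⟨a, b⟩, d⟩ <;> rcases e with _ | ⟨⟨a', b'⟩, e⟩
  · rfl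
  · have := (isDecomp_cons.1 he).1
    simp [consHead] at hde
    tauto
  · have := (isDecomp_cons.1 hd).1
    simp [consHead] at hde
    tauto
  · simpa [consHead] using hde

open Classical in
theorem sum_decomps_cons {α R : Type*} [AddCommMonoid R] (x : α) (w : List α)
    (f : List (List α × List α) → R) :
    ∑ d ∈ decomps (x :: w), f d = ∑ d ∈ decomps w, f (consHead x d) +
      ∑ i ∈ Finset.range w.length, ∑ d ∈ decomps (w.drop (i + 1)),
        f (([x], w.take (i + 1)) :: d) := by
  have h : decomps (x :: w) = (decomps w).image (consHead x) ∪
      ((Finset.range w.length).sigma fun i => decomps (w.drop (i + 1))).image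
        fun p => ([x], w.take (p.1 + 1)) :: p.2 := by
    ext d
    simp only [mem_decomps, isDecomp_cons_iff, Finset.mem_union, Finset.mem_image,
      Finset.mem_sigma, Finset.mem_range, Sigma.exists]
    grind
  rw [h, Finset.sum_union, Finset.sum_image, Finset.sum_image, Finset.sum_sigma]
  · rintro ⟨i, d⟩ hi ⟨j, e⟩ hj hij
    simp only [Finset.coe_sigma, Set.mem_sigma_iff, Finset.coe_range, Set.mem_Iio] at hi hj
    simp only [List.cons.injEq, Prod.mk.injEq, true_and] at hij
    obtain ⟨h1, rfl⟩ := hij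
    have := congrArg List.length h1
    simp at this
    obtain rfl : i = j := by omega
    rfl
  · exact fun d hd e he => consHead_injOn x w (mem_decomps.1 hd) (mem_decomps.1 he)
  -- In the first family a₁ has at least two letters unless `w = []`, and then the second family is
  -- empty.
  · rw [Finset.disjoint_left]
    intro d hd hd'
    simp only [Finset.mem_image, Finset.mem_sigma, Finset.mem_range, Sigma.exists] at hd hd'
    obtain ⟨e, he, rfl⟩ := hd
    obtain ⟨i, e', ⟨hi, -⟩, h⟩ := hd'
    rcases e with _ | ⟨⟨a, b⟩, e⟩
    · obtain rfl := isDecomp_nil.1 (mem_decomps.1 he)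
      simp at hi
    · have := (isDecomp_cons.1 (mem_decomps.1 he)).1
      simp [consHead] at h
      tauto

theorem upperFlex_cons_cons (x y : Γ × L) (a b : MouldWord Γ L) :
    upperFlex (x :: y :: a) b = x :: upperFlex (y :: a) b := by
  simp only [upperFlex, List.getLast?_cons_cons]
  cases h : (y :: a).getLast? <;> simp_all

theorem lowerFlex_cons_cons (x y : Γ × L) (a b : MouldWord Γ L) :
    lowerFlex (x :: y :: a) b = lowerFlex (y :: a) b := by
  simp only [lowerFlex, List.getLast?_cons_cons]

/-- The recursion on decompositions matches `blockSum_eq_splitSum` term by term. Singletons suffice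
in `h` because `lowerFlex` sees only the last letter of a block. -/
theorem sum_decomps_eq_ganitSum (β F : MouldWord Γ L → L) (w : MouldWord Γ L) (hβ : β [] = 1)
    (h : ∀ x c, (x :: c).Sublist w → β (lowerFlex [x] c) = polarWeight x.2 c) :
    ∑ d ∈ decomps w, (d.map fun c => β (lowerFlex c.1 c.2)).prod *
      F (d.map fun c => upperFlex c.1 c.2).flatten = ganitSum w F := by
  induction hn : w.length using Nat.strong_induction_on generalizing w F with
  | _ n ih =>
  subst hn
  rcases w with _ | ⟨x, w⟩
  · have : decomps ([] : MouldWord Γ L) = {[]} := by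
      ext d
      rcases d with _ | ⟨⟨a, b⟩, d⟩
      · simp [mem_decomps, isDecomp_nil]
      · simp [mem_decomps, isDecomp_cons]
        tauto
    simp [this]
  · rw [sum_decomps_cons, ganitSum_cons, blockSum_eq_splitSum, splitSum_eq_sum_range,
      Finset.sum_range_succ', add_comm]
    congr 1
    · refine Finset.sum_congr rfl fun i hi => ?_
      have e := ih (w.drop (i + 1)).length (by simp)
        (fun u => F ((x.1 * upperProd (w.take (i + 1)), x.2) :: u)) (w.drop (i + 1))
        (fun y c hc => h y c (hc.trans ((List.drop_sublist _ _).trans (List.sublist_cons_self _ _))))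
        rfl
      rw [← e, Finset.mul_sum]
      refine Finset.sum_congr rfl fun d _ => ?_
      rw [List.map_cons, List.prod_cons, h x _ ((List.take_sublist _ _).cons_cons x), mul_assoc]
      rfl
    · rw [List.drop_zero, List.take_zero, polarWeight_nil, one_mul, upperProd_nil, mul_one,
        ← ih w.length (by simp) _ w (fun y c hc => h y c (hc.trans (List.sublist_cons_self _ _)))
          rfl]
      refine Finset.sum_congr rfl fun d hd => ?_
      rcases d with _ | ⟨⟨a, b⟩, d⟩
      · simp [consHead, lowerFlex, upperFlex, hβ]
      · obtain ⟨y, a, rfl⟩ := List.exists_cons_of_ne_nil (isDecomp_cons.1 (mem_decomps.1 hd)).1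
        simp [consHead, lowerFlex_cons_cons, upperFlex_cons_cons]

theorem map_blockSum (φ : K →ₐ[ℚ] L) (x : Γ × K) (w : MouldWord Γ K)
    {F : MouldWord Γ K → K} {F' : MouldWord Γ L → L} (h : ∀ u, φ (F u) = F' (mapWord φ u)) :
    φ (blockSum x w F) = blockSum (x.1, φ x.2) (mapWord φ w) F' := by
  induction w generalizing x F F' with
  | nil => exact h _
  | cons y w ih =>
    rw [mapWord_cons, blockSum_cons, blockSum_cons, map_add, map_mul, map_inv₀, map_sub,
      ih (x.1 * y.1, x.2) h, ih y (F' := fun u => F' ((x.1, φ x.2) :: u)) fun u => h _]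

theorem map_ganitSum (φ : K →ₐ[ℚ] L) (w : MouldWord Γ K)
    {F : MouldWord Γ K → K} {F' : MouldWord Γ L → L} (h : ∀ u, φ (F u) = F' (mapWord φ u)) :
    φ (ganitSum w F) = ganitSum (mapWord φ w) F' := by
  cases w with
  | nil => exact h _
  | cons x w => exact map_blockSum φ x w h

theorem eval_ganit_pic (A : Mould Γ) {w : MouldWord Γ L} (h : Indep w) :
    (ganit pic A).eval w = ganitSum w A.eval := by
  obtain ⟨m, σ, φ, rfl⟩ := h.exists_mapWord
  rw [← map_eval, eval_genericWord, ← map_ganitSum φ _ (map_eval φ A), ganit,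
    sum_decomps_eq_ganitSum]
  · rw [eval_pic indep_nil]; rfl
  · intro x c hc
    have hs := ((indep_genericWord σ).of_sublist hc).shift
    simp only [lowerFlex, List.getLast?_singleton]
    rw [eval_pic hs, polarWeight, List.map_map]
    rfl

end Eval
end Mould

/-! ### Symmetries, exponentials and ganit_v(pic) -/

namespace Mould

section Symmetries

set_option linter.unusedSectionVars false

variable {Γ : Type*} [CommGroup Γ] {K L : Type} [Field K] [Algebra ℚ K] [Field L] [Algebra ℚ L]

/-! ### `quasiSum` and the products of words -/

theorem linearCombination_prepend (F : MouldWord Γ L → L) (a : Γ × L) (f : MouldWord Γ L →₀ L) :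
    Finsupp.linearCombination L F (prepend a f) =
      Finsupp.linearCombination L (fun u => F (a :: u)) f :=
  Finsupp.linearCombination_mapDomain L _ f

theorem evalLin_eq_linearCombination (M : Mould Γ) (f : MouldWord Γ L →₀ L) :
    M.evalLin f = Finsupp.linearCombination L M.eval f := rfl

theorem linearCombination_shuffle : ∀ (ω η : MouldWord Γ L) (F : MouldWord Γ L → L),
    Finsupp.linearCombination L F (shuffle ω η) = quasiSum 0 ω η F
  | [], η, F => by simp [shuffle]
  | a :: ω, [], F => by simp [shuffle]
  | a :: ω, b :: η, F => by
    rw [shuffle, map_add, linearCombination_prepend, linearCombination_prepend,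
      linearCombination_shuffle ω (b :: η), linearCombination_shuffle (a :: ω) η,
      quasiSum_cons_cons]
    simp
termination_by ω η => ω.length + η.length

/-- Disjointness keeps the recursion away from the branch where ш_* is declared to be 0. -/
theorem linearCombination_shuffleStar : ∀ (ω η : MouldWord Γ L) (F : MouldWord Γ L → L),
    (ω.map Prod.snd).Disjoint (η.map Prod.snd) →
    Finsupp.linearCombination L F (shuffleStar ω η) = quasiSum 1 ω η F
  | [], η, F, _ => by simp [shuffleStar]
  | a :: ω, [], F, _ => by simp [shuffleStar]
  | a :: ω, b :: η, F, h => by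
    simp only [List.map_cons, List.disjoint_cons_left, List.disjoint_cons_right,
      List.mem_cons, not_or] at h
    obtain ⟨⟨hab, h1⟩, h2, h3⟩ := h
    rw [shuffleStar, if_neg (Ne.symm hab)]
    simp only [map_add, map_smul, map_sub, linearCombination_prepend]
    rw [linearCombination_shuffleStar ω (b :: η) _
        (by rw [List.map_cons, List.disjoint_cons_right]; tauto),
      linearCombination_shuffleStar (a :: ω) η _
        (by rw [List.map_cons, List.disjoint_cons_left]; tauto),
      linearCombination_shuffleStar ω η _ h3, linearCombination_shuffleStar ω η _ h3,
      quasiSum_cons_cons]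
    simp
termination_by ω η => ω.length + η.length

theorem map_quasiSum (κ : ℕ) (φ : K →ₐ[ℚ] L) : ∀ (ω η : MouldWord Γ K)
    (F : MouldWord Γ K → K) (F' : MouldWord Γ L → L), (∀ u, φ (F u) = F' (mapWord φ u)) →
    φ (quasiSum κ ω η F) = quasiSum κ (mapWord φ ω) (mapWord φ η) F'
  | [], η, F, F', h => by simp [h]
  | a :: ω, [], F, F', h => by simp [h]
  | a :: ω, b :: η, F, F', h => by
    simp only [mapWord_cons, quasiSum_cons_cons, map_add, map_mul, map_sub, map_inv₀, map_natCast]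
    rw [map_quasiSum κ φ ω (b :: η) _ (fun u => F' ((a.1, φ a.2) :: u)) fun u => h (a :: u),
      map_quasiSum κ φ (a :: ω) η _ (fun u => F' ((b.1, φ b.2) :: u)) fun u => h (b :: u),
      map_quasiSum κ φ ω η _ (fun u => F' ((a.1 * b.1, φ a.2) :: u))
        fun u => h ((a.1 * b.1, a.2) :: u),
      map_quasiSum κ φ ω η _ (fun u => F' ((a.1 * b.1, φ b.2) :: u))
        fun u => h ((a.1 * b.1, b.2) :: u)]
    rfl
termination_by ω η => ω.length + η.length

/-! ### Alternal, alternil, symmetral and symmetril moulds -/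

/-- `M(ω ⋆ η) = c M(ω) M(η)` for all nonempty words of variables, where `⋆` is the shuffle product
(`κ = 0`) or `ш_*` (`κ = 1`). -/
def IsQuasiShuffle (κ c : ℕ) (M : Mould Γ) : Prop :=
  ∀ (p q : ℕ), 1 ≤ p → 1 ≤ q → ∀ (σ : Fin p → Γ) (τ : Fin q → Γ),
    quasiSum κ (varWord 0 σ) (varWord p τ) M.eval =
      c * (M.eval (varWord 0 σ) * M.eval (varWord p τ))

theorem varWord_append {p q : ℕ} (σ : Fin p → Γ) (τ : Fin q → Γ) :
    varWord 0 σ ++ varWord p τ =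
      List.ofFn fun i => (Fin.append σ τ i, RatField.var (i : ℕ)) := by
  rw [varWord, varWord, ← List.ofFn_fin_append]
  congr 1
  funext i
  refine Fin.addCases (fun i => ?_) (fun i => ?_) i <;> simp

theorem indep_varWord_append {p q : ℕ} (σ : Fin p → Γ) (τ : Fin q → Γ) :
    Indep (varWord 0 σ ++ varWord p τ) := by
  rw [varWord_append]
  exact indep_ofFn ((RatField.algebraicIndependent_var ℕ).comp _ Fin.val_injective)

theorem Indep.disjoint {ω η : MouldWord Γ L} (h : Indep (ω ++ η)) :
    (ω.map Prod.snd).Disjoint (η.map Prod.snd) := by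
  have := h.nodup
  rw [List.map_append] at this
  exact List.disjoint_of_nodup_append this

theorem mem_ARIal_iff {M : Mould Γ} : M ∈ ARIal Γ ↔ M ∈ ARI Γ ∧ IsQuasiShuffle 0 0 M := by
  simp [ARIal, IsQuasiShuffle, evalLin_eq_linearCombination, linearCombination_shuffle]

theorem mem_GARIas_iff {M : Mould Γ} : M ∈ GARIas Γ ↔ M ∈ GARI Γ ∧ IsQuasiShuffle 0 1 M := by
  simp [GARIas, IsQuasiShuffle, evalLin_eq_linearCombination, linearCombination_shuffle]

theorem mem_ARIil_iff {M : Mould Γ} : M ∈ ARIil Γ ↔ M ∈ ARI Γ ∧ IsQuasiShuffle 1 0 M := by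
  have h := fun (p q : ℕ) (σ : Fin p → Γ) (τ : Fin q → Γ) =>
    linearCombination_shuffleStar _ _ M.eval (indep_varWord_append σ τ).disjoint
  simp [ARIil, IsQuasiShuffle, evalLin_eq_linearCombination, h]

theorem mem_GARIis_iff {M : Mould Γ} : M ∈ GARIis Γ ↔ M ∈ GARI Γ ∧ IsQuasiShuffle 1 1 M := by
  have h := fun (p q : ℕ) (σ : Fin p → Γ) (τ : Fin q → Γ) =>
    linearCombination_shuffleStar _ _ M.eval (indep_varWord_append σ τ).disjoint
  simp [GARIis, IsQuasiShuffle, evalLin_eq_linearCombination, h]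

theorem quasiShuffle_mapWord_iff (κ c : ℕ) (M : Mould Γ) (φ : K →ₐ[ℚ] L) (ω η : MouldWord Γ K) :
    quasiSum κ (mapWord φ ω) (mapWord φ η) M.eval =
        c * (M.eval (mapWord φ ω) * M.eval (mapWord φ η)) ↔
      quasiSum κ ω η M.eval = c * (M.eval ω * M.eval η) := by
  rw [← map_quasiSum κ φ ω η M.eval M.eval (map_eval φ M), ← map_eval, ← map_eval,
    ← map_mul, ← map_natCast φ c, ← map_mul]
  exact φ.injective.eq_iff

/-- The relation defining `IsQuasiShuffle` holds for all words with algebraically independent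
entries. -/
theorem IsQuasiShuffle.apply {κ c : ℕ} {M : Mould Γ} (h : IsQuasiShuffle κ c M)
    {ω η : MouldWord Γ L} (hi : Indep (ω ++ η)) (hω : ω ≠ []) (hη : η ≠ []) :
    quasiSum κ ω η M.eval = c * (M.eval ω * M.eval η) := by
  obtain ⟨p, hp⟩ : ∃ p, ω.length = p := ⟨_, rfl⟩
  obtain ⟨q, hq⟩ : ∃ q, η.length = q := ⟨_, rfl⟩
  obtain ⟨m, σ, φ, hφ⟩ := hi.exists_mapWord
  obtain rfl : m = p + q := by
    have := congrArg List.length hφ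
    simpa [genericWord, hp, hq] using this
  -- The given words and the words of variables are both images of the generic word in p + q
  -- variables, under `φ` and `ψ`; injectivity carries the relation between them.
  let ψ : RatField (Fin (p + q)) →ₐ[ℚ] RatField ℕ := RatField.substHom
    ((RatField.algebraicIndependent_var ℕ).comp _ Fin.val_injective)
  have hψ : ∀ i, ψ (RatField.var i) = RatField.var (i : ℕ) := RatField.substHom_var _
  let ω₀ : MouldWord Γ (RatField (Fin (p + q))) :=
    List.ofFn fun i : Fin p => (σ (Fin.castAdd q i), RatField.var (Fin.castAdd q i))
  let η₀ : MouldWord Γ (RatField (Fin (p + q))) :=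
    List.ofFn fun i : Fin q => (σ (Fin.natAdd p i), RatField.var (Fin.natAdd p i))
  have e : genericWord σ = ω₀ ++ η₀ := by
    rw [genericWord, List.ofFn_add]
    rfl
  rw [e, mapWord_append] at hφ
  obtain ⟨rfl, rfl⟩ := List.append_inj hφ (by simp [ω₀, hp])
  rw [quasiShuffle_mapWord_iff, ← quasiShuffle_mapWord_iff κ c M ψ]
  have e1 : mapWord ψ ω₀ = varWord 0 fun i => σ (Fin.castAdd q i) := by
    simp [ω₀, mapWord, varWord, List.map_ofFn, Function.comp_def, hψ]
  have e2 : mapWord ψ η₀ = varWord p fun i => σ (Fin.natAdd p i) := by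
    simp [η₀, mapWord, varWord, List.map_ofFn, Function.comp_def, hψ]
  rw [e1, e2]
  refine h p q ?_ ?_ _ _
  · rw [← hp]
    exact List.length_pos_iff.2 hω
  · rw [← hq]
    exact List.length_pos_iff.2 hη

/-! ### Exponentials -/

/-- The divided power `A^{× k} / k!`, evaluated at a word. -/
def divPow (A : Mould Γ) (k : ℕ) (w : MouldWord Γ L) : L :=
  ((k.factorial : L))⁻¹ * (A.pow k).eval w

theorem divPow_zero (A : Mould Γ) {w : MouldWord Γ L} (h : Indep w) :
    divPow A 0 w = if w = [] then 1 else 0 := by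
  rw [divPow, pow, eval_unit h]
  simp

theorem divPow_succ (A : Mould Γ) (k : ℕ) {w : MouldWord Γ L} (h : Indep w) :
    ((k : L) + 1) * divPow A (k + 1) w = splitSum w fun c w' => divPow A k c * A.eval w' := by
  have : CharZero L := algebraRat.charZero L
  have h1 : (k : L) + 1 ≠ 0 := by exact_mod_cast k.succ_ne_zero
  simp only [divPow, mul_assoc]
  rw [splitSum_fun_mul, ← eval_pow_succ A k h, Nat.factorial_succ]
  push_cast
  field_simp

theorem quasiSum_zero_fun (κ : ℕ) (ω η : MouldWord Γ L) : quasiSum κ ω η (fun _ => 0) = 0 :=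
  (quasiSum κ ω η).map_zero

theorem quasiSum_indicator_nil (κ : ℕ) (ω η : MouldWord Γ L) :
    quasiSum κ ω η (fun u => if u = [] then 1 else 0) =
      (if ω = [] then 1 else 0) * (if η = [] then 1 else 0) := by
  rcases ω with _ | ⟨a, ω⟩
  · simp
  rcases η with _ | ⟨b, η⟩
  · simp
  simp [quasiSum_cons_cons, quasiSum_zero_fun]

theorem splitSum_mul_indicator_nil (g : MouldWord Γ L → L) (w : MouldWord Γ L) :
    (splitSum w fun c w' => g c * if w' = [] then 1 else 0) = g w := by
  induction w generalizing g with
  | nil => simp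
  | cons x w ih => rw [splitSum_cons, ih fun u => g (x :: u)]; simp

/-- With A(∅) = 0 the vanishing relation extends to empty words and says that `A` is primitive. -/
theorem IsQuasiShuffle.apply_primitive {κ : ℕ} {A : Mould Γ} (hA : A ∈ ARI Γ)
    (h : IsQuasiShuffle κ 0 A) {ω η : MouldWord Γ L} (hi : Indep (ω ++ η)) :
    quasiSum κ ω η A.eval = A.eval ω * (if η = [] then 1 else 0) +
      (if ω = [] then 1 else 0) * A.eval η := by
  by_cases hω : ω = []
  · subst hω
    simp [eval_nil_of_mem_ARI hA]
  by_cases hη : η = []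
  · subst hη
    simp [eval_nil_of_mem_ARI hA]
  simp [h.apply hi hω hη, hω, hη]

/-- Divided powers of a primitive element have the binomial coproduct. Multiplying by k + 1 peels
off one factor `A`, which by primitivity acts on `ω` alone or on `η` alone; on the other side k + 1
= i + j. -/
theorem quasiSum_divPow {κ : ℕ} {A : Mould Γ} (hA : A ∈ ARI Γ) (h : IsQuasiShuffle κ 0 A)
    (k : ℕ) (ω η : MouldWord Γ L) (hi : Indep (ω ++ η)) :
    quasiSum κ ω η (divPow A k) =
      ∑ ij ∈ Finset.HasAntidiagonal.antidiagonal k, divPow A ij.1 ω * divPow A ij.2 η := by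
  have : CharZero L := algebraRat.charZero L
  induction k generalizing ω η with
  | zero =>
    rw [quasiSum_congr (F' := fun u => if u = [] then 1 else 0)
      fun u hu => divPow_zero A (hi.of_subperm hu), quasiSum_indicator_nil]
    simp [divPow_zero A (hi.of_sublist (List.sublist_append_left _ _)),
      divPow_zero A (hi.of_sublist (List.sublist_append_right _ _))]
  | succ k ih =>
    have hk : (k : L) + 1 ≠ 0 := by exact_mod_cast k.succ_ne_zero
    refine mul_left_cancel₀ hk ?_
    have hω : Indep ω := hi.of_sublist (List.sublist_append_left _ _)
    have hη : Indep η := hi.of_sublist (List.sublist_append_right _ _)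
    have e1 : ((k : L) + 1) * quasiSum κ ω η (divPow A (k + 1)) =
        splitSum ω fun ω₁ ω₂ => splitSum η fun η₁ η₂ =>
          ∑ ij ∈ Finset.HasAntidiagonal.antidiagonal k,
            ((divPow A ij.1 ω₁ * A.eval ω₂) * (divPow A ij.2 η₁ * if η₂ = [] then 1 else 0) +
              (divPow A ij.1 ω₁ * if ω₂ = [] then 1 else 0) * (divPow A ij.2 η₁ * A.eval η₂)) := by
      rw [← map_fun_mul, quasiSum_congr (F' := fun u => splitSum u fun c w' =>
        divPow A k c * A.eval w') fun u hu => divPow_succ A k (hi.of_subperm hu),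
        quasiSum_splitSum]
      refine splitSum_congr fun ω₁ ω₂ hω' => splitSum_congr fun η₁ η₂ hη' => ?_
      subst hω' hη'
      simp only [map_fun_mul, map_fun_mul_right]
      rw [ih ω₁ η₁ (hi.of_sublist
          ((List.sublist_append_left _ _).append (List.sublist_append_left _ _))),
        h.apply_primitive hA (hi.of_sublist
          ((List.sublist_append_right _ _).append (List.sublist_append_right _ _))),
        Finset.sum_mul]
      refine Finset.sum_congr rfl fun ij _ => ?_
      ring
    have e2 : ((k : L) + 1) * ∑ ij ∈ Finset.HasAntidiagonal.antidiagonal (k + 1),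
          divPow A ij.1 ω * divPow A ij.2 η =
        ∑ ij ∈ Finset.HasAntidiagonal.antidiagonal (k + 1),
            (ij.1 * divPow A ij.1 ω) * divPow A ij.2 η +
          ∑ ij ∈ Finset.HasAntidiagonal.antidiagonal (k + 1),
            divPow A ij.1 ω * (ij.2 * divPow A ij.2 η) := by
      rw [Finset.mul_sum, ← Finset.sum_add_distrib]
      refine Finset.sum_congr rfl fun ij hij => ?_
      have : (ij.1 : L) + ij.2 = k + 1 := by
        exact_mod_cast Finset.HasAntidiagonal.mem_antidiagonal.1 hij
      rw [← this]
      ring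
    -- The boundary terms, with i = 0 or j = 0, are killed by the factor i or j, so both sums are
    -- reindexed over the antidiagonal of k.
    rw [e1, e2, Finset.Nat.sum_antidiagonal_succ, Finset.Nat.sum_antidiagonal_succ']
    simp only [splitSum_fun_sum, splitSum_fun_add, splitSum_fun_mul, splitSum_fun_mul_right,
      splitSum_mul_indicator_nil, Finset.sum_add_distrib]
    push_cast
    simp only [divPow_succ A _ hω, divPow_succ A _ hη]
    simp

theorem divPow_eq_zero {A : Mould Γ} (hA : A ∈ ARI Γ) {k : ℕ} {w : MouldWord Γ L} (h : Indep w)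
    (hk : w.length < k) : divPow A k w = 0 := by
  rw [divPow, eval_pow_eq_zero hA h hk, mul_zero]

theorem eval_expTimes_eq_sum_divPow {A : Mould Γ} (hA : A ∈ ARI Γ) {w : MouldWord Γ L}
    (h : Indep w) {N : ℕ} (hN : w.length < N) :
    (expTimes A).eval w = ∑ k ∈ Finset.range N, divPow A k w := eval_expTimes hA h hN

theorem isQuasiShuffle_expTimes {κ : ℕ} {A : Mould Γ} (hA : A ∈ ARI Γ)
    (h : IsQuasiShuffle κ 0 A) : IsQuasiShuffle κ 1 (expTimes A) := by
  intro p q _ _ σ τ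
  have hi := indep_varWord_append σ τ
  generalize varWord 0 σ = ω at *
  generalize varWord p τ = η at *
  have hω : Indep ω := hi.of_sublist (List.sublist_append_left _ _)
  have hη : Indep η := hi.of_sublist (List.sublist_append_right _ _)
  have e1 : quasiSum κ ω η (expTimes A).eval =
      quasiSum κ ω η fun u => ∑ k ∈ Finset.range (ω.length + η.length + 1), divPow A k u := by
    refine quasiSum_congr fun u hu => eval_expTimes_eq_sum_divPow hA (hi.of_subperm hu) ?_
    have := hu.length_le
    simp only [List.length_map, List.length_append] at this
    omega
  -- To regroup the product of two truncated exponentials by total degree, they are made polynomials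
  -- in an auxiliary variable, set to 1 at the end.
  have coeff : ∀ {w : MouldWord Γ (RatField ℕ)}, Indep w → ∀ k, (∑ i ∈ Finset.range (w.length + 1),
      Polynomial.monomial i (divPow A i w)).coeff k = divPow A k w := by
    intro w hw k
    simp only [Polynomial.finsetSum_coeff, Polynomial.coeff_monomial, Finset.sum_ite_eq',
      Finset.mem_range]
    split_ifs with hk
    · rfl
    · exact (divPow_eq_zero hA hw (by omega)).symm
  have eval_one : ∀ {w : MouldWord Γ (RatField ℕ)}, Indep w →
      (expTimes A).eval w = (∑ i ∈ Finset.range (w.length + 1),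
        Polynomial.monomial i (divPow A i w)).eval 1 := by
    intro w hw
    rw [eval_expTimes_eq_sum_divPow hA hw (Nat.lt_succ_self _), Polynomial.eval_finsetSum]
    simp
  have deg : ∀ w : MouldWord Γ (RatField ℕ), (∑ i ∈ Finset.range (w.length + 1),
      Polynomial.monomial i (divPow A i w)).natDegree ≤ w.length := by
    intro w
    refine Polynomial.natDegree_sum_le_of_forall_le _ _ fun i hi => ?_
    exact (Polynomial.natDegree_monomial_le _).trans (by simpa [Nat.lt_succ_iff] using hi)
  rw [e1, map_fun_sum, eval_one hω, eval_one hη, ← Polynomial.eval_mul, Nat.cast_one, one_mul,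
    Polynomial.eval_eq_sum_range' (n := ω.length + η.length + 1)
      (Nat.lt_succ_of_le (Polynomial.natDegree_mul_le.trans (add_le_add (deg ω) (deg η))))]
  refine Finset.sum_congr rfl fun k _ => ?_
  rw [one_pow, mul_one, Polynomial.coeff_mul]
  simp only [coeff hω, coeff hη]
  exact quasiSum_divPow hA h k ω η hi

theorem expTimes_mem_GARI {A : Mould Γ} (hA : A ∈ ARI Γ) : expTimes A ∈ GARI Γ := by
  have hi := indep_genericWord (Γ := Γ) ![]
  change expTimes A 0 ![] = 1
  rw [apply_zero_eq_eval (expTimes A),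
    eval_expTimes_eq_sum_divPow hA hi (N := 1) (by simp [genericWord]), Finset.sum_range_one,
    divPow_zero A hi]
  simp [genericWord]

/-! ### The map `ganit pic` -/

theorem ganit_pic_apply_zero (A : Mould Γ) : ganit pic A 0 ![] = A 0 ![] := by
  rw [apply_zero_eq_eval (ganit pic A), apply_zero_eq_eval A, eval_ganit_pic A (indep_genericWord _)]
  simp [genericWord]

theorem ganit_pic_mem_ARI {A : Mould Γ} (hA : A ∈ ARI Γ) : ganit pic A ∈ ARI Γ :=
  (ganit_pic_apply_zero A).trans hA

theorem ganit_pic_mem_GARI {A : Mould Γ} (hA : A ∈ GARI Γ) : ganit pic A ∈ GARI Γ :=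
  (ganit_pic_apply_zero A).trans hA

theorem ganit_pic_mul (A B : Mould Γ) :
    ganit pic (mul A B) = mul (ganit pic A) (ganit pic B) := by
  refine ext_eval fun m σ => ?_
  have hi := indep_genericWord σ
  rw [eval_ganit_pic _ hi, eval_mul _ _ hi, ganitSum_congr fun u hu _ =>
    eval_mul A B (hi.of_subperm hu.subperm), ganitSum_splitSum]
  refine splitSum_congr fun c w' hw => ?_
  rw [eval_ganit_pic A (hi.of_sublist (hw ▸ List.sublist_append_left _ _)),
    eval_ganit_pic B (hi.of_sublist (hw ▸ List.sublist_append_right _ _))]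
  simp only [map_fun_mul, map_fun_mul_right]

theorem ganit_pic_unit : ganit pic (unit : Mould Γ) = unit := by
  refine ext_eval fun m σ => ?_
  have hi := indep_genericWord σ
  rw [eval_ganit_pic _ hi, eval_unit hi]
  generalize genericWord σ = w at *
  rw [ganitSum_congr (F' := fun _ => if w = [] then 1 else 0)]
  · rcases w with _ | ⟨x, w⟩
    · simp
    · simp only [reduceCtorEq, if_false]
      exact (ganitSum (x :: w)).map_zero
  · intro u hu hne
    rw [eval_unit (hi.of_subperm hu.subperm)]
    congr 1
    refine propext ⟨fun h => ?_, fun h => ?_⟩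
    · by_contra h'
      exact hne h' h
    · subst h
      simpa using hu

theorem ganit_pic_pow (A : Mould Γ) (k : ℕ) : ganit pic (A.pow k) = (ganit pic A).pow k := by
  induction k with
  | zero => exact ganit_pic_unit
  | succ k ih => rw [pow, ganit_pic_mul, ih, pow]

theorem ganit_pic_expTimes {A : Mould Γ} (hA : A ∈ ARI Γ) :
    ganit pic (expTimes A) = expTimes (ganit pic A) := by
  refine ext_eval fun m σ => ?_
  have hi := indep_genericWord σ
  rw [eval_ganit_pic _ hi, eval_expTimes (ganit_pic_mem_ARI hA) hi (Nat.lt_succ_self _),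
    ganitSum_congr fun u hu _ => eval_expTimes hA (hi.of_subperm hu.subperm)
      (N := (genericWord σ).length + 1) (by simpa [Nat.lt_succ_iff] using hu.length_le),
    map_fun_sum]
  refine Finset.sum_congr rfl fun k _ => ?_
  rw [map_fun_mul, ← ganit_pic_pow, eval_ganit_pic _ hi]

/-- Dual to the homomorphism property of `ganitSum`: the contracted words stay nonempty and jointly
independent, so the relation for `M` applies to each pair. -/
theorem isQuasiShuffle_ganit_pic {c : ℕ} {M : Mould Γ} (h : IsQuasiShuffle 0 c M) :
    IsQuasiShuffle 1 c (ganit pic M) := by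
  intro p q hp hq σ τ
  have hi := indep_varWord_append σ τ
  have hω₀ : varWord 0 σ ≠ [] := by
    simp [varWord, List.ofFn_eq_nil_iff]; omega
  have hη₀ : varWord p τ ≠ [] := by
    simp [varWord, List.ofFn_eq_nil_iff]; omega
  generalize varWord 0 σ = ω at *
  generalize varWord p τ = η at *
  have hω : Indep ω := hi.of_sublist (List.sublist_append_left _ _)
  have hη : Indep η := hi.of_sublist (List.sublist_append_right _ _)
  rw [eval_ganit_pic M hω, eval_ganit_pic M hη,
    quasiSum_congr fun u hu => eval_ganit_pic M (hi.of_subperm hu),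
    quasiSum_one_ganitSum _ _ _ (by simpa using hi.nodup), ganitShuffle,
    ganitSum_congr (F' := fun u => ganitSum η fun v => c * (M.eval u * M.eval v))]
  · simp only [map_fun_mul, map_fun_mul_right]
  · intro u hu hu'
    refine ganitSum_congr fun v hv hv' => h.apply (hi.of_subperm ?_) (hu' hω₀) (hv' hη₀)
    rw [List.map_append, List.map_append]
    exact (hu.append hv).subperm

end Symmetries
end Mould

end

/-! ### The commuting square -/

theorem mainTheorem6 (Γ : Type*) [CommGroup Γ] [Finite Γ] :
    -- `ganit_v(pic)` commutes with `exp_×`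
    (∀ A ∈ Mould.ARI Γ,
      Mould.ganit Mould.pic (Mould.expTimes A) = Mould.expTimes (Mould.ganit Mould.pic A)) ∧
    -- the four arrows of the square are well defined, and the square commutes
    ∃ (expAl : Set.MapsTo Mould.expTimes (Mould.ARIal Γ) (Mould.GARIas Γ))
      (expIl : Set.MapsTo Mould.expTimes (Mould.ARIil Γ) (Mould.GARIis Γ))
      (ganitARI : Set.MapsTo (Mould.ganit Mould.pic) (Mould.ARIal Γ) (Mould.ARIil Γ))
      (ganitGARI : Set.MapsTo (Mould.ganit Mould.pic) (Mould.GARIas Γ) (Mould.GARIis Γ)),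
      ganitGARI.restrict _ _ _ ∘ expAl.restrict _ _ _ =
        expIl.restrict _ _ _ ∘ ganitARI.restrict _ _ _ := by
  refine ⟨fun A hA => Mould.ganit_pic_expTimes hA, fun A hA => ?_, fun A hA => ?_,
    fun A hA => ?_, fun A hA => ?_, ?_⟩
  · rw [Mould.mem_ARIal_iff] at hA
    exact Mould.mem_GARIas_iff.2
      ⟨Mould.expTimes_mem_GARI hA.1, Mould.isQuasiShuffle_expTimes hA.1 hA.2⟩
  · rw [Mould.mem_ARIil_iff] at hA
    exact Mould.mem_GARIis_iff.2
      ⟨Mould.expTimes_mem_GARI hA.1, Mould.isQuasiShuffle_expTimes hA.1 hA.2⟩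
  · rw [Mould.mem_ARIal_iff] at hA
    exact Mould.mem_ARIil_iff.2
      ⟨Mould.ganit_pic_mem_ARI hA.1, Mould.isQuasiShuffle_ganit_pic hA.2⟩
  · rw [Mould.mem_GARIas_iff] at hA
    exact Mould.mem_GARIis_iff.2
      ⟨Mould.ganit_pic_mem_GARI hA.1, Mould.isQuasiShuffle_ganit_pic hA.2⟩
  · funext A
    exact Subtype.ext (Mould.ganit_pic_expTimes A.2.1)
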